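/- Let $\mathcal{A}$ be a finite alphabet with at least two letters. Words over $\mathcal A$ are the elements of the free monoid $\mathcal{A}^*$, and a morphism is a non-erasing monoid homomorphism $\sigma:\mathcal{A}^*\to\mathcal{A}^*$. A shift space is a closed set $X\subset\mathcal{A}^{\mathbb Z}$ with $S(X)=X$, where $S$ is the shift map $S((x_n)_n)=(x_{n+1})_n$; its language $\mathcal{L}(X)$ is the set of all finite factors of its elements, and $X$ is over $\mathcal A$ if every letter of $\mathcal A$ occurs in $\mathcal L(X)$. The extension graph of $w\in\mathcal{L}(X)$ is the bipartite graph whose vertex set is the disjoint union of $\{a\in\mathcal A : aw\in\mathcal{L}(X)\}$ and $\{b\in\mathcal A: wb\in\mathcal{L}(X)\}$, with an edge between $a$ and $b$ whenever $awb\in\mathcal{L}(X)$. A shift space $X$ is dendric if the extension graph of every $w\in\mathcal{L}(X)$ is a tree. The image of $X$ under $\sigma$ is $\{S^k\sigma(x) : x\in X,\ 0\le k<|\sigma(x_0)|\}$. The morphism $\sigma$ is strongly left proper if there is a letter $\ell$ such that every $\sigma(a)$, $a\in\mathcal A$, starts with $\ell$ and contains $\ell$ exactly once. It preserves dendricity if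 the image under $\sigma$ of every dendric shift over $\mathcal A$ is a dendric shift. For $a\in\mathcal A$, the Arnoux-Rauzy morphisms $\alpha_a,\bar\alpha_a$ are given by $\alpha_a(a)=\bar\alpha_a(a)=a$ and $\alpha_a(b)=ab$, $\bar\alpha_a(b)=ba$ for $b\ne a$. Proposition. The morphisms $\sigma:\mathcal{A}^*\to\mathcal{A}^*$ that are injective, strongly left proper and preserve dendricity are exactly the morphisms $$\bar{\alpha}_{a_1}\circ\cdots\circ\bar{\alpha}_{a_n}\circ\alpha_\ell\circ\pi$$ with $\ell\in\mathcal A$, $n\ge 0$, $a_1,\dots,a_n\in\mathcal{A}\setminus\{\ell\}$ and $\pi$ a permutation of $\mathcal{A}$ (extended to a morphism of $\mathcal A^*$). -/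

import Mathlib

namespace DendricShift

/-! Words over `A` are lists; morphisms are monoid homomorphisms between free monoids. -/

/-- The word `x_k x_{k+1} ⋯ x_{k+n-1}` read in the bi-infinite word `x`. -/
def window {A : Type*} (x : ℤ → A) (k : ℤ) (n : ℕ) : List A :=
  List.ofFn fun i : Fin n => x (k + (i : ℤ))

/-- The language of a set `X` of bi-infinite words: all finite factors of its elements. -/
def language {A : Type*} (X : Set (ℤ → A)) : Set (List A) :=
  {w | ∃ x ∈ X, ∃ k : ℤ, w = window x k w.length}

/-- The shift map, `(S x)_n = x_{n+1}`. -/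
def shift {A : Type*} (x : ℤ → A) : ℤ → A := fun n => x (n + 1)

/-- A shift space: a closed subset of `A^ℤ` with `S(X) = X`. -/
structure IsShiftSpace {A : Type*} [TopologicalSpace A] (X : Set (ℤ → A)) : Prop where
  isClosed : IsClosed X
  shift_image : shift '' X = X

/-- `X` is over `A`: every letter of `A` occurs in `X`. -/
def IsOverAlphabet {A : Type*} (X : Set (ℤ → A)) : Prop :=
  ∀ a : A, [a] ∈ language X

/-- Left extensions of `w` in `F`. -/
def leftExt {A : Type*} (F : Set (List A)) (w : List A) : Set A := {a | a :: w ∈ F}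

/-- Right extensions of `w` in `F`. -/
def rightExt {A : Type*} (F : Set (List A)) (w : List A) : Set A := {b | w ++ [b] ∈ F}

/-- The extension graph of `w` in `F`: its vertex set is the disjoint union of the left and of the
right extensions of `w`, and a left vertex `a` is joined to a right vertex `b` iff `a w b ∈ F`. -/
def extensionGraph {A : Type*} (F : Set (List A)) (w : List A) :
    SimpleGraph (leftExt F w ⊕ rightExt F w) where
  Adj u v :=
    (∃ (a : leftExt F w) (b : rightExt F w), u = Sum.inl a ∧ v = Sum.inr b ∧
      (a : A) :: (w ++ [(b : A)]) ∈ F) ∨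
    (∃ (a : leftExt F w) (b : rightExt F w), v = Sum.inl a ∧ u = Sum.inr b ∧
      (a : A) :: (w ++ [(b : A)]) ∈ F)
  symm := ⟨fun _ _ h => h.symm⟩
  loopless := ⟨by
    rintro u (⟨a, b, h₁, h₂, -⟩ | ⟨a, b, h₁, h₂, -⟩) <;> rw [h₁] at h₂ <;> cases h₂⟩

/-- A dendric shift: a shift space such that the extension graph of every word of its language
is a tree. -/
structure IsDendricShift {A : Type*} [TopologicalSpace A] (X : Set (ℤ → A)) : Prop where
  isShiftSpace : IsShiftSpace X
  isTree : ∀ w ∈ language X, (extensionGraph (language X) w).IsTree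

/-- The image `σ(a)` of a letter, as a list. -/
def letterImage {A B : Type*} (σ : FreeMonoid A →* FreeMonoid B) (a : A) : List B :=
  FreeMonoid.toList (σ (FreeMonoid.of a))

/-- `z` is the bi-infinite word `σ(x) = ⋯ σ(x_{-1}) . σ(x_0) σ(x_1) ⋯`, where `σ(x_0)` starts at
position `0`; here `L n` is the position at which `σ(x_n)` starts. If `σ` is non-erasing then there
is exactly one such `z`. -/
def IsBiinfiniteImage {A B : Type*} (σ : FreeMonoid A →* FreeMonoid B)
    (x : ℤ → A) (z : ℤ → B) : Prop :=
  ∃ L : ℤ → ℤ, L 0 = 0 ∧ (∀ n, L (n + 1) = L n + ((letterImage σ (x n)).length : ℤ)) ∧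
    ∀ n, window z (L n) (letterImage σ (x n)).length = letterImage σ (x n)

/-- The image `{S^k σ(x) | x ∈ X, 0 ≤ k < |σ(x_0)|}` of `X` under `σ`. -/
def shiftImage {A B : Type*} (σ : FreeMonoid A →* FreeMonoid B) (X : Set (ℤ → A)) :
    Set (ℤ → B) :=
  {y | ∃ x ∈ X, ∃ z, IsBiinfiniteImage σ x z ∧
    ∃ k < (letterImage σ (x 0)).length, y = shift^[k] z}

/-- `σ` is strongly left proper: for some letter `ℓ`, every `σ(a)` starts with `ℓ` and contains
exactly one occurrence of `ℓ`. Such a `σ` is non-erasing. -/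
def IsStronglyLeftProper {A B : Type*} [DecidableEq B] (σ : FreeMonoid A →* FreeMonoid B) : Prop :=
  ∃ ℓ : B, ∀ a : A, [ℓ] <+: letterImage σ a ∧ (letterImage σ a).count ℓ = 1

/-- `σ` preserves dendricity: the image of every dendric shift over `A` is a dendric shift. -/
def PreservesDendricity {A B : Type*} [TopologicalSpace A] [TopologicalSpace B]
    (σ : FreeMonoid A →* FreeMonoid B) : Prop :=
  ∀ X : Set (ℤ → A), IsDendricShift X → IsOverAlphabet X → IsDendricShift (shiftImage σ X)

/-- The Arnoux-Rauzy morphism `α_a`: `a ↦ a` and `b ↦ a b` for `b ≠ a`. -/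
def arnouxRauzy {A : Type*} [DecidableEq A] (a : A) : FreeMonoid A →* FreeMonoid A :=
  FreeMonoid.lift fun b =>
    if b = a then FreeMonoid.of a else FreeMonoid.of a * FreeMonoid.of b

/-- The Arnoux-Rauzy morphism `ᾱ_a`: `a ↦ a` and `b ↦ b a` for `b ≠ a`. -/
def arnouxRauzyBar {A : Type*} [DecidableEq A] (a : A) : FreeMonoid A →* FreeMonoid A :=
  FreeMonoid.lift fun b =>
    if b = a then FreeMonoid.of a else FreeMonoid.of b * FreeMonoid.of a

/-- The composition `ᾱ_{a₁} ∘ ⋯ ∘ ᾱ_{aₙ} ∘ τ`, where `as = [a₁, …, aₙ]`. -/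
def arnouxRauzyBarComp {A : Type*} [DecidableEq A] (as : List A)
    (τ : FreeMonoid A →* FreeMonoid A) : FreeMonoid A →* FreeMonoid A :=
  as.foldr (fun a ρ => (arnouxRauzyBar a).comp ρ) τ

end DendricShift

/-!
The words `w` of the language of a dendric shift have trees as extension graphs, and everything
below happens at the level of languages: for non-erasing `σ`, the image of a shift space is a shift
space (`isShiftSpace_shiftImage`, a projection along a compact space) whose language consists of the
factors of the words `σ(v)` (`language_shiftImage`).

*The listed morphisms preserve dendricity.* In the image under `α_a`, one of any two consecutive
letters is `a`. Hence the extension graph of the empty word is a double star with both centres `a`,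
and a word that starts or ends with another letter has a star as extension graph. A word that starts
and ends with `a` is `α_a(v) a` for a unique `v`, and has the extension graph of `v`
(`IsDendricLanguage.arnouxRauzy`). The morphism `ᾱ_a` gives the same language as its conjugate
`α_a`.

*There are no others.* Acyclicity is used only in the form `NoSquare`: no extension graph contains a
4-cycle. Write `σ(x) = ℓ u_x`. Let `s` be the longest common suffix and `p` the longest common prefix
of the words `u_x`, let `f x` be the letter before `s` in `ℓ u_x` and `g x` the letter after `p` in
`u_x ℓ`. Neither `f` nor `g` is constant. If `x y` occurs in `X`, then `f x · s ℓ p · g y` occurs in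
its image, so the extension graph of `s ℓ p` contains the extension graph of the empty word of `X`
with its left vertices glued along `f` and its right vertices along `g`. The test shifts `X` consist
of the words `⋯ c c d d ⋯`, where `c = d` or `c → d` is an edge of an oriented star
(`isDendricShift_starShift`). Applied to all oriented stars, the absence of 4-cycles makes `f` and
`g` injective (`injective_of_starRel`), hence bijective.

Let `a` be the first letter of `s ℓ` and `b` the last letter of `ℓ p`. Bijectivity puts the double
star of all `z a` and all `b z` into the extension graph of the empty word, which then has no other
edge: a letter other than `b` is followed by `a`. If some `u_x` is empty, then `a = b = ℓ`, each `u_x`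
has at most one letter, and `σ` is `α_ℓ` composed with the permutation `g`. Otherwise `a` and `b`
differ from `ℓ`, and `a = b`, since otherwise only letters `a` could follow `ℓ`; so
`σ = ᾱ_a ∘ τ` (`eq_arnouxRauzy_or_isChain`). The hypotheses on `σ` pass to `τ`, whose images are
shorter, and induction on the total length of the images of the letters concludes
(`exists_eq_arnouxRauzyBarComp`).
-/

namespace DendricShift

/-! ### Trees and extension graphs -/

/-- A graph in which every vertex except a root `r` has a parent of smaller height, and whose only
edges join a vertex to its parent, is a tree: on a cycle, both neighbours of a vertex of greatest
height would be its parent. -/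
theorem isTree_of_parent {V : Type*} (G : SimpleGraph V) (r : V) (p : V → V) (h : V → ℕ)
    (hp : ∀ v, v ≠ r → G.Adj v (p v) ∧ h (p v) < h v)
    (hadj : ∀ u v, G.Adj u v → (u ≠ r ∧ v = p u) ∨ (v ≠ r ∧ u = p v)) : G.IsTree := by
  classical
  have hreach : ∀ n v, h v ≤ n → G.Reachable v r := by
    intro n
    induction n with
    | zero =>
      intro v hv
      by_cases hvr : v = r
      · rw [hvr]
      · have := (hp v hvr).2; omega
    | succ n ih =>
      intro v hv
      by_cases hvr : v = r
      · rw [hvr]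
      · exact (hp v hvr).1.reachable.trans (ih _ (by have := (hp v hvr).2; omega))
  have : Nonempty V := ⟨r⟩
  refine ⟨⟨fun u v => (hreach _ u le_rfl).trans (hreach _ v le_rfl).symm⟩, ?_⟩
  intro v c hc
  obtain ⟨u, hu, hmax⟩ := c.support.toFinset.exists_max_image h
    ⟨v, by simp⟩
  have hu' : u ∈ c.support := by simpa using hu
  have hc' := hc.rotate hu'
  set d := c.rotate u hu' with hd
  have hsup : ∀ x ∈ d.support, h x ≤ h u := by
    intro x hx
    exact hmax x (by simpa [hd] using hx)
  have key : ∀ x, x ∈ d.support → G.Adj u x → x = p u := by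
    intro x hx hux
    rcases hadj u x hux with ⟨_, h2⟩ | ⟨h1, h2⟩
    · exact h2
    · have := (hp x h1).2
      have := hsup x hx
      rw [← h2] at *
      omega
  have h1 := key d.snd (d.getVert_mem_support 1) (d.adj_snd hc'.not_nil)
  have h2 := key d.penultimate (d.getVert_mem_support _) (d.adj_penultimate hc'.not_nil).symm
  exact hc'.snd_ne_penultimate (h1.trans h2.symm)

theorem extensionGraph_adj_inl_inr {A : Type*} {F : Set (List A)} {w : List A}
    (a : leftExt F w) (b : rightExt F w) :
    (extensionGraph F w).Adj (Sum.inl a) (Sum.inr b) ↔ (a : A) :: (w ++ [(b : A)]) ∈ F := by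
  constructor
  · rintro (⟨a', b', h1, h2, h⟩ | ⟨a', b', h1, h2, h⟩)
    · cases h1; cases h2; exact h
    · cases h1
  · exact fun h => Or.inl ⟨a, b, rfl, rfl, h⟩

theorem extensionGraph_not_adj_inl_inl {A : Type*} {F : Set (List A)} {w : List A}
    (a b : leftExt F w) : ¬ (extensionGraph F w).Adj (Sum.inl a) (Sum.inl b) := by
  rintro (⟨a', b', h1, h2, h⟩ | ⟨a', b', h1, h2, h⟩) <;> cases h2

theorem extensionGraph_not_adj_inr_inr {A : Type*} {F : Set (List A)} {w : List A}
    (a b : rightExt F w) : ¬ (extensionGraph F w).Adj (Sum.inr a) (Sum.inr b) := by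
  rintro (⟨a', b', h1, h2, h⟩ | ⟨a', b', h1, h2, h⟩) <;> cases h1

theorem extensionGraph_isTree_of_parent {A : Type*} {F : Set (List A)} {w : List A}
    (r : leftExt F w) (p : leftExt F w → rightExt F w) (q : rightExt F w → leftExt F w)
    (h : leftExt F w ⊕ rightExt F w → ℕ)
    (hp : ∀ a, a ≠ r → (a : A) :: (w ++ [(p a : A)]) ∈ F ∧ h (Sum.inr (p a)) < h (Sum.inl a))
    (hq : ∀ b, (q b : A) :: (w ++ [(b : A)]) ∈ F ∧ h (Sum.inl (q b)) < h (Sum.inr b))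
    (hadj : ∀ (a : leftExt F w) (b : rightExt F w), (a : A) :: (w ++ [(b : A)]) ∈ F →
      (a ≠ r ∧ b = p a) ∨ a = q b) :
    (extensionGraph F w).IsTree := by
  refine isTree_of_parent _ (Sum.inl r) (Sum.elim (fun a => Sum.inr (p a)) fun b => Sum.inl (q b))
    h ?_ ?_
  · rintro (a | b) hne
    · have := hp a (fun h => hne (by rw [h]))
      exact ⟨(extensionGraph_adj_inl_inr _ _).2 this.1, this.2⟩
    · exact ⟨((extensionGraph_adj_inl_inr _ _).2 (hq b).1).symm, (hq b).2⟩
  · rintro (a | b) (a' | b') hab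
    · exact absurd hab (extensionGraph_not_adj_inl_inl _ _)
    · rcases hadj a b' ((extensionGraph_adj_inl_inr _ _).1 hab) with ⟨h1, h2⟩ | h1
      · exact Or.inl ⟨by simpa using h1, by simp [h2]⟩
      · exact Or.inr ⟨by simp, by simp [h1]⟩
    · rcases hadj a' b ((extensionGraph_adj_inl_inr _ _).1 hab.symm) with ⟨h1, h2⟩ | h1
      · exact Or.inr ⟨by simpa using h1, by simp [h2]⟩
      · exact Or.inl ⟨by simp, by simp [h1]⟩
    · exact absurd hab (extensionGraph_not_adj_inr_inr _ _)

/-- A double star: the edges of the extension graph are those through the left vertex `a` or the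
right vertex `b`. -/
theorem extensionGraph_isTree_of_doubleStar {A : Type*} {F : Set (List A)} {w : List A} {a b : A}
    (ha : a ∈ leftExt F w) (hb : b ∈ rightExt F w)
    (h : ∀ c ∈ leftExt F w, ∀ d ∈ rightExt F w, c :: (w ++ [d]) ∈ F ↔ c = a ∨ d = b) :
    (extensionGraph F w).IsTree := by
  classical
  refine extensionGraph_isTree_of_parent ⟨a, ha⟩ (fun _ => ⟨b, hb⟩) (fun _ => ⟨a, ha⟩)
    (Sum.elim (fun c => if (c : A) = a then 0 else 2) fun _ => 1) ?_ ?_ ?_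
  · rintro ⟨c, hc⟩ hne
    have hne' : c ≠ a := fun e => hne (by simp [e])
    exact ⟨(h c hc b hb).2 (Or.inr rfl), by simp [hne']⟩
  · rintro ⟨d, hd⟩
    exact ⟨(h a ha d hd).2 (Or.inl rfl), by simp⟩
  · rintro ⟨c, hc⟩ ⟨d, hd⟩ hcd
    by_cases hca : c = a
    · exact Or.inr (by simp [hca])
    · refine Or.inl ⟨by simpa using hca, ?_⟩
      have := (h c hc d hd).1 hcd
      simp only [hca, false_or] at this
      simp [this]

/-- Being a tree only depends on the edges of the extension graph, up to a renaming of the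
letters. -/
theorem extensionGraph_isTree_congr {A B : Type*} {F : Set (List A)} {G : Set (List B)}
    {w : List A} {v : List B} (e : A ≃ B) (hl : ∀ a, a :: w ∈ F ↔ e a :: v ∈ G)
    (hr : ∀ b, w ++ [b] ∈ F ↔ v ++ [e b] ∈ G)
    (h : ∀ a b, a :: (w ++ [b]) ∈ F ↔ e a :: (v ++ [e b]) ∈ G)
    (hG : (extensionGraph G v).IsTree) : (extensionGraph F w).IsTree := by
  let i : extensionGraph F w ≃g extensionGraph G v :=
    { toEquiv := Equiv.sumCongr (e.subtypeEquiv hl) (e.subtypeEquiv hr)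
      map_rel_iff' := by
        rintro (a | b) (a' | b')
        · exact iff_of_false (extensionGraph_not_adj_inl_inl _ _)
            (extensionGraph_not_adj_inl_inl _ _)
        · exact (extensionGraph_adj_inl_inr _ _).trans
            ((h _ _).symm.trans (extensionGraph_adj_inl_inr _ _).symm)
        · rw [SimpleGraph.adj_comm, SimpleGraph.adj_comm _ (Sum.inr b)]
          exact (extensionGraph_adj_inl_inr _ _).trans
            ((h _ _).symm.trans (extensionGraph_adj_inl_inr _ _).symm)
        · exact iff_of_false (extensionGraph_not_adj_inr_inr _ _)
            (extensionGraph_not_adj_inr_inr _ _) }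
  exact i.isTree_iff.2 hG

/-- No extension graph of `F` has a cycle of length four. This is the part of acyclicity that is
needed to pin down a morphism from its action on dendric shifts. -/
def NoSquare {A : Type*} (F : Set (List A)) : Prop :=
  ∀ (w : List A) (a a' b b' : A), a :: (w ++ [b]) ∈ F → a :: (w ++ [b']) ∈ F →
    a' :: (w ++ [b]) ∈ F → a' :: (w ++ [b']) ∈ F → a = a' ∨ b = b'

/-- Closed under taking factors. -/
def Factorial {A : Type*} (F : Set (List A)) : Prop :=
  ∀ w ∈ F, ∀ v, v <:+: w → v ∈ F

theorem noSquare_of_isTree {A : Type*} {F : Set (List A)} (hF : Factorial F)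
    (hT : ∀ w ∈ F, (extensionGraph F w).IsTree) : NoSquare F := by
  intro w a a' b b' h1 h2 h3 h4
  by_contra hne
  push Not at hne
  have hw : w ∈ F := hF _ h1 _ ⟨[a], [b], by simp⟩
  have la : a ∈ leftExt F w := hF _ h1 _ ⟨[], [b], by simp⟩
  have la' : a' ∈ leftExt F w := hF _ h3 _ ⟨[], [b], by simp⟩
  have rb : b ∈ rightExt F w := hF _ h1 _ ⟨[a], [], by simp⟩
  have rb' : b' ∈ rightExt F w := hF _ h2 _ ⟨[a], [], by simp⟩
  have e1 := (extensionGraph_adj_inl_inr ⟨a, la⟩ ⟨b, rb⟩).2 h1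
  have e2 := (extensionGraph_adj_inl_inr ⟨a, la⟩ ⟨b', rb'⟩).2 h2
  have e3 := (extensionGraph_adj_inl_inr ⟨a', la'⟩ ⟨b, rb⟩).2 h3
  have e4 := (extensionGraph_adj_inl_inr ⟨a', la'⟩ ⟨b', rb'⟩).2 h4
  have hpath := (SimpleGraph.isAcyclic_iff_subsingleton_path.1 (hT w hw).isAcyclic _ _).elim
    ⟨.cons e1 (.cons e3.symm .nil), by simp [hne.1]⟩
    ⟨.cons e2 (.cons e4.symm .nil), by simp [hne.1]⟩
  simp at hpath
  exact hne.2 hpath.1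


/-! ### Images of words and of languages -/

section Images
variable {A B C : Type*}

/-- The image `σ(w)` of a word, as a list. -/
def wordImage (σ : FreeMonoid A →* FreeMonoid B) (w : List A) : List B :=
  FreeMonoid.toList (σ (FreeMonoid.ofList w))

@[simp] theorem wordImage_nil (σ : FreeMonoid A →* FreeMonoid B) : wordImage σ [] = [] := by
  simp [wordImage]

@[simp] theorem wordImage_append (σ : FreeMonoid A →* FreeMonoid B) (u v : List A) :
    wordImage σ (u ++ v) = wordImage σ u ++ wordImage σ v := by
  simp [wordImage, FreeMonoid.ofList_append, FreeMonoid.toList_mul]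

theorem wordImage_cons (σ : FreeMonoid A →* FreeMonoid B) (a : A) (v : List A) :
    wordImage σ (a :: v) = letterImage σ a ++ wordImage σ v := by
  simp [wordImage, letterImage, FreeMonoid.ofList_cons, FreeMonoid.toList_mul]

theorem wordImage_singleton (σ : FreeMonoid A →* FreeMonoid B) (a : A) :
    wordImage σ [a] = letterImage σ a := rfl

theorem wordImage_comp (σ : FreeMonoid B →* FreeMonoid C) (τ : FreeMonoid A →* FreeMonoid B)
    (w : List A) : wordImage (σ.comp τ) w = wordImage σ (wordImage τ w) := by
  simp [wordImage]

theorem letterImage_comp (σ : FreeMonoid B →* FreeMonoid C) (τ : FreeMonoid A →* FreeMonoid B)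
    (a : A) : letterImage (σ.comp τ) a = wordImage σ (letterImage τ a) := by
  simp [wordImage, letterImage]

theorem hom_ext_of_letterImage {σ τ : FreeMonoid A →* FreeMonoid B}
    (h : ∀ a, letterImage σ a = letterImage τ a) : σ = τ :=
  FreeMonoid.hom_eq fun a => FreeMonoid.toList.injective (h a)

theorem injective_iff_wordImage {σ : FreeMonoid A →* FreeMonoid B} :
    Function.Injective σ ↔ Function.Injective (wordImage σ) := Iff.rfl

theorem wordImage_infix (σ : FreeMonoid A →* FreeMonoid B) {u v : List A} (h : u <:+: v) :
    wordImage σ u <:+: wordImage σ v := by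
  obtain ⟨s, t, rfl⟩ := h
  exact ⟨wordImage σ s, wordImage σ t, by simp⟩

/-- The language of all factors of the words `σ(v)`, `v ∈ F`. -/
def imageLang (σ : FreeMonoid A →* FreeMonoid B) (F : Set (List A)) : Set (List B) :=
  {w | ∃ v ∈ F, w <:+: wordImage σ v}

theorem factorial_imageLang (σ : FreeMonoid A →* FreeMonoid B) (F : Set (List A)) :
    Factorial (imageLang σ F) := by
  rintro w ⟨v, hv, hw⟩ u hu
  exact ⟨v, hv, hu.trans hw⟩

theorem imageLang_comp (σ : FreeMonoid B →* FreeMonoid C) (τ : FreeMonoid A →* FreeMonoid B)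
    (F : Set (List A)) : imageLang (σ.comp τ) F = imageLang σ (imageLang τ F) := by
  ext w
  constructor
  · rintro ⟨v, hv, hw⟩
    exact ⟨wordImage τ v, ⟨v, hv, List.infix_refl _⟩, by rwa [← wordImage_comp]⟩
  · rintro ⟨u, ⟨v, hv, hu⟩, hw⟩
    exact ⟨v, hv, by rw [wordImage_comp]; exact hw.trans (wordImage_infix σ hu)⟩

/-- Every word of `F` can be extended in `F` by a letter on both sides. -/
def Extendable (F : Set (List A)) : Prop :=
  ∀ w ∈ F, ∃ a b, a :: (w ++ [b]) ∈ F

theorem Extendable.exists_right {F : Set (List A)} (hF : Factorial F) (hE : Extendable F)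
    {w : List A} (hw : w ∈ F) : ∃ b, w ++ [b] ∈ F := by
  obtain ⟨a, b, h⟩ := hE w hw
  exact ⟨b, hF _ h _ ⟨[a], [], by simp⟩⟩

theorem Extendable.exists_left {F : Set (List A)} (hF : Factorial F) (hE : Extendable F)
    {w : List A} (hw : w ∈ F) : ∃ a, a :: w ∈ F := by
  obtain ⟨a, b, h⟩ := hE w hw
  exact ⟨a, hF _ h _ ⟨[], [b], by simp⟩⟩

theorem extendable_imageLang {σ : FreeMonoid A →* FreeMonoid B}
    (hσ : ∀ a, letterImage σ a ≠ []) {F : Set (List A)} (hE : Extendable F) :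
    Extendable (imageLang σ F) := by
  rintro w ⟨v, hv, s, t, hw⟩
  obtain ⟨c, d, hcd⟩ := hE v hv
  obtain ⟨s', x, hs⟩ := List.eq_nil_or_concat (letterImage σ c ++ s) |>.resolve_left
    (by simp [hσ c])
  obtain ⟨y, t', ht⟩ := List.exists_cons_of_ne_nil (l := t ++ letterImage σ d) (by simp [hσ d])
  refine ⟨x, y, _, hcd, s', t', ?_⟩
  rw [wordImage_cons, wordImage_append, wordImage_singleton, ← hw]
  have : letterImage σ c ++ (s ++ w ++ t ++ letterImage σ d) =
    (letterImage σ c ++ s) ++ w ++ (t ++ letterImage σ d) := by simp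
  rw [this, hs, ht]; simp

/-- A word with a single left extension has a star as extension graph. -/
theorem extensionGraph_isTree_of_leftExt {F : Set (List A)} (hF : Factorial F)
    (hE : Extendable F) {w : List A} (hw : w ∈ F) {a : A} (h : ∀ c ∈ leftExt F w, c = a) :
    (extensionGraph F w).IsTree := by
  obtain ⟨x, y, hxy⟩ := hE w hw
  have hx : x ∈ leftExt F w := hF _ hxy _ ⟨[], [y], by simp⟩
  obtain rfl := h x hx
  refine extensionGraph_isTree_of_doubleStar hx (b := y) (hF _ hxy _ ⟨[x], [], by simp⟩) ?_
  intro c hc d hd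
  refine iff_of_true ?_ (Or.inl (h c hc))
  obtain ⟨z, hz⟩ := hE.exists_left hF hd
  rw [h c hc]
  rwa [h z (hF _ hz _ ⟨[], [d], by simp⟩)] at hz

theorem extensionGraph_isTree_of_rightExt {F : Set (List A)} (hF : Factorial F)
    (hE : Extendable F) {w : List A} (hw : w ∈ F) {b : A} (h : ∀ d ∈ rightExt F w, d = b) :
    (extensionGraph F w).IsTree := by
  obtain ⟨x, y, hxy⟩ := hE w hw
  have hy : y ∈ rightExt F w := hF _ hxy _ ⟨[x], [], by simp⟩
  obtain rfl := h y hy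
  refine extensionGraph_isTree_of_doubleStar (a := x) (hF _ hxy _ ⟨[], [y], by simp⟩) hy ?_
  intro c hc d hd
  refine iff_of_true ?_ (Or.inr (h d hd))
  obtain ⟨z, hz⟩ := hE.exists_right hF hc
  rw [h d hd]
  rwa [h z (hF _ hz _ ⟨[c], [], by simp⟩)] at hz

/-- The languages of the dendric shifts over `A`. -/
structure IsDendricLanguage (F : Set (List A)) : Prop where
  factorial : Factorial F
  extendable : Extendable F
  singleton_mem : ∀ a, [a] ∈ F
  isTree : ∀ w ∈ F, (extensionGraph F w).IsTree

end Images

/-! ### Arnoux-Rauzy morphisms -/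

section ArnouxRauzy
variable {A : Type*} [DecidableEq A]

theorem letterImage_arnouxRauzy (a b : A) :
    letterImage (arnouxRauzy a) b = if b = a then [a] else [a, b] := by
  simp only [letterImage, arnouxRauzy, FreeMonoid.lift_eval_of]
  split_ifs <;> rfl

theorem letterImage_arnouxRauzyBar (a b : A) :
    letterImage (arnouxRauzyBar a) b = if b = a then [a] else [b, a] := by
  simp only [letterImage, arnouxRauzyBar, FreeMonoid.lift_eval_of]
  split_ifs <;> rfl

/-- `α_a` and `ᾱ_a` are conjugate. -/
theorem arnouxRauzy_append_eq (a : A) (v : List A) :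
    wordImage (arnouxRauzy a) v ++ [a] = a :: wordImage (arnouxRauzyBar a) v := by
  induction v with
  | nil => simp
  | cons c v ih =>
    rw [wordImage_cons, wordImage_cons, letterImage_arnouxRauzy, letterImage_arnouxRauzyBar,
      List.append_assoc, ih]
    split_ifs <;> simp_all

theorem letterImage_arnouxRauzy_eq_cons (a b : A) :
    ∃ l, letterImage (arnouxRauzy a) b = a :: l := by
  rw [letterImage_arnouxRauzy]; split_ifs <;> simp

theorem letterImage_arnouxRauzy_eq_concat (a b : A) :
    ∃ l, letterImage (arnouxRauzy a) b = l ++ [b] := by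
  rw [letterImage_arnouxRauzy]; split_ifs with h
  · exact ⟨[], by simp [h]⟩
  · exact ⟨[a], rfl⟩

theorem wordImage_arnouxRauzy_injective (a : A) :
    Function.Injective (wordImage (arnouxRauzy a)) := by
  intro u
  induction u using List.reverseRecOn with
  | nil =>
    intro v h
    cases v with
    | nil => rfl
    | cons c v =>
      obtain ⟨l, hl⟩ := letterImage_arnouxRauzy_eq_cons a c
      simp [wordImage_cons, hl] at h
  | append_singleton u c ih =>
    intro v h
    obtain ⟨l, hl⟩ := letterImage_arnouxRauzy_eq_concat a c
    rcases List.eq_nil_or_concat v with rfl | ⟨v, d, rfl⟩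
    · simp [wordImage_singleton, hl] at h
    · obtain ⟨l', hl'⟩ := letterImage_arnouxRauzy_eq_concat a d
      have hcd : c = d := by
        rw [List.concat_eq_append, wordImage_append, wordImage_append, wordImage_singleton,
          wordImage_singleton, hl, hl', ← List.append_assoc, ← List.append_assoc] at h
        simpa using (List.append_inj' h rfl).2
      subst hcd
      rw [List.concat_eq_append, wordImage_append, wordImage_append] at h
      rw [ih (List.append_cancel_right h), List.concat_eq_append]

theorem wordImage_arnouxRauzyBar_injective (a : A) :
    Function.Injective (wordImage (arnouxRauzyBar a)) := by
  intro u v h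
  apply wordImage_arnouxRauzy_injective a
  have := arnouxRauzy_append_eq a u
  rw [h, ← arnouxRauzy_append_eq a v] at this
  exact List.append_cancel_right this

/-- Desubstitution: cutting `α_a(u)` in front of an `a` cuts `u`. -/
theorem exists_append_of_wordImage_arnouxRauzy (a : A) :
    ∀ (u s t : List A), wordImage (arnouxRauzy a) u = s ++ a :: t →
      ∃ u₁ u₂, u = u₁ ++ u₂ ∧ wordImage (arnouxRauzy a) u₁ = s ∧
        wordImage (arnouxRauzy a) u₂ = a :: t := by
  intro u
  induction u with
  | nil => intro s t h; simp at h
  | cons c u ih =>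
    intro s t h
    rcases s with _ | ⟨x, s⟩
    · exact ⟨[], c :: u, rfl, by simp, h⟩
    rw [wordImage_cons, letterImage_arnouxRauzy] at h
    split_ifs at h with hca
    · simp only [List.cons_append, List.nil_append, List.cons.injEq] at h
      obtain ⟨rfl, h⟩ := h
      obtain ⟨u₁, u₂, rfl, h1, h2⟩ := ih s t h
      exact ⟨c :: u₁, u₂, rfl, by rw [wordImage_cons, h1, letterImage_arnouxRauzy]; simp [hca], h2⟩
    · simp only [List.cons_append, List.nil_append, List.cons.injEq] at h
      obtain ⟨rfl, h⟩ := h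
      rcases s with _ | ⟨y, s⟩
      · simp [hca] at h
      · simp only [List.cons_append, List.cons.injEq] at h
        obtain ⟨rfl, h⟩ := h
        obtain ⟨u₁, u₂, rfl, h1, h2⟩ := ih s t h
        exact ⟨c :: u₁, u₂, rfl, by rw [wordImage_cons, h1, letterImage_arnouxRauzy]; simp [hca],
          h2⟩

theorem letterImage_arnouxRauzy_ne_nil (a b : A) : letterImage (arnouxRauzy a) b ≠ [] := by
  rw [letterImage_arnouxRauzy]; split_ifs <;> simp

theorem imageLang_arnouxRauzyBar (a : A) {F : Set (List A)} (hF : Factorial F)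
    (hE : Extendable F) : imageLang (arnouxRauzyBar a) F = imageLang (arnouxRauzy a) F := by
  have hL (c : A) : ∃ l, letterImage (arnouxRauzyBar a) c = l ++ [a] := by
    rw [letterImage_arnouxRauzyBar]; split_ifs
    · exact ⟨[], rfl⟩
    · exact ⟨[c], rfl⟩
  ext w
  constructor
  · rintro ⟨v, hv, hw⟩
    obtain ⟨d, hd⟩ := hE.exists_right hF hv
    obtain ⟨l, hl⟩ := letterImage_arnouxRauzy_eq_cons a d
    refine ⟨_, hd, hw.trans ⟨[a], l, ?_⟩⟩
    rw [wordImage_append, wordImage_singleton, hl, List.singleton_append, ← arnouxRauzy_append_eq]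
    simp
  · rintro ⟨v, hv, hw⟩
    obtain ⟨c, hc⟩ := hE.exists_left hF hv
    obtain ⟨l, hl⟩ := hL c
    refine ⟨_, hc, hw.trans ⟨l, [a], ?_⟩⟩
    rw [wordImage_cons, hl, List.append_assoc, List.append_assoc, arnouxRauzy_append_eq]
    simp

/-- The extensions `x α_a(v) a y` come from the extensions `x v y`. -/
theorem mem_imageLang_arnouxRauzy_iff (a : A) {F : Set (List A)} (hF : Factorial F)
    (hE : Extendable F) (v : List A) (x y : A) :
    x :: (wordImage (arnouxRauzy a) v ++ [a] ++ [y]) ∈ imageLang (arnouxRauzy a) F ↔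
      x :: (v ++ [y]) ∈ F := by
  constructor
  · rintro ⟨u, hu, s, t, h⟩
    obtain ⟨r, hr⟩ : ∃ r, wordImage (arnouxRauzy a) v ++ a :: y :: t = a :: r := by
      have := arnouxRauzy_append_eq a v
      exact ⟨wordImage (arnouxRauzyBar a) v ++ y :: t, by
        rw [← List.cons_append, ← this]; simp⟩
    have h1 : wordImage (arnouxRauzy a) u = (s ++ [x]) ++ a :: r := by
      rw [← h, ← hr]; simp
    obtain ⟨u₁, u₂, rfl, hu₁, hu₂⟩ := exists_append_of_wordImage_arnouxRauzy a _ _ _ h1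
    rw [← hr] at hu₂
    obtain ⟨u₃, u₄, rfl, hu₃, hu₄⟩ := exists_append_of_wordImage_arnouxRauzy a _ _ _ hu₂
    obtain rfl := wordImage_arnouxRauzy_injective a hu₃
    obtain ⟨u₁', c, rfl⟩ : ∃ u₁' c, u₁ = u₁' ++ [c] := by
      rcases List.eq_nil_or_concat u₁ with rfl | ⟨u', c, rfl⟩
      · simp at hu₁
      · exact ⟨u', c, List.concat_eq_append⟩
    obtain rfl : c = x := by
      obtain ⟨l, hl⟩ := letterImage_arnouxRauzy_eq_concat a c
      rw [wordImage_append, wordImage_singleton, hl, ← List.append_assoc] at hu₁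
      simpa using (List.append_inj' hu₁ rfl).2
    obtain ⟨u₄', rfl⟩ : ∃ u₄', u₄ = y :: u₄' := by
      rcases u₄ with _ | ⟨d, u₄⟩
      · simp at hu₄
      refine ⟨u₄, ?_⟩
      rw [wordImage_cons, letterImage_arnouxRauzy] at hu₄
      split_ifs at hu₄ with hda
      · rcases u₄ with _ | ⟨e, u₄⟩
        · simp at hu₄
        · obtain ⟨l, hl⟩ := letterImage_arnouxRauzy_eq_cons a e
          simp only [wordImage_cons, hl, List.cons_append, List.nil_append, List.cons.injEq] at hu₄
          rw [hda, hu₄.2.1]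
      · simp only [List.cons_append, List.nil_append, List.cons.injEq] at hu₄
        rw [hu₄.2.1]
    exact hF _ hu _ ⟨u₁', u₄', by simp⟩
  · intro h
    obtain ⟨z, hz⟩ := hE.exists_right hF h
    obtain ⟨l, hl⟩ := letterImage_arnouxRauzy_eq_concat a x
    obtain ⟨l', hl'⟩ : ∃ l', letterImage (arnouxRauzy a) y ++ letterImage (arnouxRauzy a) z =
        a :: y :: l' := by
      obtain ⟨k, hk⟩ := letterImage_arnouxRauzy_eq_cons a z
      rw [hk, letterImage_arnouxRauzy]
      split_ifs with hya
      · exact ⟨k, by simp [hya]⟩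
      · exact ⟨a :: k, by simp⟩
    refine ⟨_, hz, l, l', ?_⟩
    have : x :: (v ++ [y]) ++ [z] = [x] ++ v ++ ([y] ++ [z]) := by simp
    rw [this, wordImage_append, wordImage_append, wordImage_append _ [y], wordImage_singleton,
      wordImage_singleton, wordImage_singleton, hl, hl']
    simp

theorem left_mem_imageLang_arnouxRauzy_iff (a : A) {F : Set (List A)} (hF : Factorial F)
    (hE : Extendable F) (v : List A) (x : A) :
    x :: (wordImage (arnouxRauzy a) v ++ [a]) ∈ imageLang (arnouxRauzy a) F ↔ x :: v ∈ F := by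
  constructor
  · intro h
    obtain ⟨y, hy⟩ := (extendable_imageLang (letterImage_arnouxRauzy_ne_nil a) hE).exists_right
      (factorial_imageLang _ _) h
    exact hF _ ((mem_imageLang_arnouxRauzy_iff a hF hE v x y).1 hy) _ ⟨[], [y], by simp⟩
  · intro h
    obtain ⟨y, hy⟩ := hE.exists_right hF h
    exact factorial_imageLang _ _ _ ((mem_imageLang_arnouxRauzy_iff a hF hE v x y).2 hy) _
      ⟨[], [y], by simp⟩

theorem right_mem_imageLang_arnouxRauzy_iff (a : A) {F : Set (List A)} (hF : Factorial F)
    (hE : Extendable F) (v : List A) (y : A) :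
    wordImage (arnouxRauzy a) v ++ [a] ++ [y] ∈ imageLang (arnouxRauzy a) F ↔ v ++ [y] ∈ F := by
  constructor
  · intro h
    obtain ⟨x, hx⟩ := (extendable_imageLang (letterImage_arnouxRauzy_ne_nil a) hE).exists_left
      (factorial_imageLang _ _) h
    exact hF _ ((mem_imageLang_arnouxRauzy_iff a hF hE v x y).1 hx) _ ⟨[x], [], by simp⟩
  · intro h
    obtain ⟨x, hx⟩ := hE.exists_left hF h
    exact factorial_imageLang _ _ _ ((mem_imageLang_arnouxRauzy_iff a hF hE v x y).2 hx) _
      ⟨[x], [], by simp⟩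

/-- In the image of `α_a`, of two consecutive letters one is `a`. -/
theorem eq_or_eq_of_mem_imageLang_arnouxRauzy {a c d : A} {F : Set (List A)}
    (h : [c, d] ∈ imageLang (arnouxRauzy a) F) : c = a ∨ d = a := by
  obtain ⟨u, -, s, t, h⟩ := h
  by_contra hne
  push Not at hne
  -- The letter `d ≠ a` of `α_a(u)` is preceded by `a`, inside the image of one letter.
  have key : ∀ (u s : List A), wordImage (arnouxRauzy a) u = s ++ c :: d :: t → False := by
    intro u
    induction u with
    | nil => intro s h; simp at h
    | cons e u ih =>
      intro s h
      rw [wordImage_cons, letterImage_arnouxRauzy] at h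
      split_ifs at h with hea
      · rcases s with _ | ⟨x, s⟩
        · simp only [List.cons_append, List.nil_append, List.cons.injEq] at h
          exact hne.1 h.1.symm
        · simp only [List.cons_append, List.nil_append, List.cons.injEq] at h
          exact ih s h.2
      · rcases s with _ | ⟨x, _ | ⟨y, s⟩⟩
        · simp only [List.cons_append, List.nil_append, List.cons.injEq] at h
          exact hne.1 h.1.symm
        · simp only [List.cons_append, List.nil_append, List.cons.injEq] at h
          rcases u with _ | ⟨f, u⟩
          · simp at h
          · obtain ⟨l, hl⟩ := letterImage_arnouxRauzy_eq_cons a f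
            simp only [wordImage_cons, hl, List.cons_append, List.cons.injEq] at h
            exact hne.2 h.2.2.1.symm
        · simp only [List.cons_append, List.nil_append, List.cons.injEq] at h
          exact ih s h.2.2
  exact key u s (by rw [← h]; simp)

theorem IsDendricLanguage.arnouxRauzy {F : Set (List A)} (hF : IsDendricLanguage F) (a : A) :
    IsDendricLanguage (imageLang (arnouxRauzy a) F) := by
  have hfac := factorial_imageLang (DendricShift.arnouxRauzy a) F
  have hext := extendable_imageLang (letterImage_arnouxRauzy_ne_nil a) hF.extendable
  -- The letters before and after `a`: the case `v = []` of the desubstitution.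
  have hleft (c : A) : [c, a] ∈ imageLang (DendricShift.arnouxRauzy a) F := by
    simpa using (left_mem_imageLang_arnouxRauzy_iff a hF.factorial hF.extendable [] c).2
      (hF.singleton_mem c)
  have hright (c : A) : [a, c] ∈ imageLang (DendricShift.arnouxRauzy a) F := by
    simpa using (right_mem_imageLang_arnouxRauzy_iff a hF.factorial hF.extendable [] c).2
      (hF.singleton_mem c)
  have hsing (c : A) : [c] ∈ imageLang (DendricShift.arnouxRauzy a) F :=
    hfac _ (hleft c) _ ⟨[], [a], rfl⟩
  refine ⟨hfac, hext, hsing, ?_⟩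
  intro w hw
  obtain ⟨x₀, y₀, hxy⟩ := hext w hw
  have hy₀ : y₀ ∈ rightExt (imageLang (DendricShift.arnouxRauzy a) F) w :=
    hfac _ hxy _ ⟨[x₀], [], by simp⟩
  rcases w with _ | ⟨b, w⟩
  · refine extensionGraph_isTree_of_doubleStar (a := a) (b := a) (hsing a) (hsing a) ?_
    intro c _ d _
    refine ⟨fun h => eq_or_eq_of_mem_imageLang_arnouxRauzy h, ?_⟩
    rintro (rfl | rfl)
    · exact hright d
    · exact hleft c
  by_cases hb : b = a
  swap
  · -- A word that starts with `b ≠ a` is only preceded by `a`.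
    refine extensionGraph_isTree_of_leftExt hfac hext hw (a := a) fun c hc => ?_
    exact (eq_or_eq_of_mem_imageLang_arnouxRauzy
      (hfac _ hc [c, b] ⟨[], w, by simp⟩)).resolve_right hb
  subst hb
  obtain ⟨w', e, he⟩ : ∃ w' e, b :: w = w' ++ [e] := by
    rcases List.eq_nil_or_concat (b :: w) with h | ⟨w', e, h⟩
    · simp at h
    · exact ⟨w', e, by rw [h, List.concat_eq_append]⟩
  by_cases hea : e = b
  swap
  · -- A word that ends with `e ≠ a` is only followed by `a`.
    refine extensionGraph_isTree_of_rightExt hfac hext hw (b := b) fun c hc => ?_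
    exact (eq_or_eq_of_mem_imageLang_arnouxRauzy
      (hfac _ hc [e, c] ⟨w', [], by simp [he]⟩)).resolve_left hea
  subst hea
  -- A word that starts and ends with `a` is of the form `α_a(v) a`, and has the extensions of `v`.
  obtain ⟨v, hv, hwv⟩ : ∃ v ∈ F, e :: w = wordImage (DendricShift.arnouxRauzy e) v ++ [e] := by
    obtain ⟨u, hu, s, t, h⟩ := hy₀
    obtain ⟨u₁, u₂, rfl, hu₁, hu₂⟩ := exists_append_of_wordImage_arnouxRauzy e u s
      (w ++ y₀ :: t) (by rw [← h]; simp)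
    have : wordImage (DendricShift.arnouxRauzy e) u₂ = w' ++ e :: (y₀ :: t) := by
      rw [hu₂, ← List.cons_append, he]; simp
    obtain ⟨u₃, u₄, rfl, hu₃, hu₄⟩ := exists_append_of_wordImage_arnouxRauzy e _ _ _ this
    exact ⟨u₃, hF.factorial _ hu _ ⟨u₁, u₄, by simp⟩, by rw [he, hu₃]⟩
  rw [hwv]
  exact extensionGraph_isTree_congr (Equiv.refl A)
    (left_mem_imageLang_arnouxRauzy_iff e hF.factorial hF.extendable v)
    (right_mem_imageLang_arnouxRauzy_iff e hF.factorial hF.extendable v)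
    (mem_imageLang_arnouxRauzy_iff e hF.factorial hF.extendable v) (hF.isTree v hv)

theorem IsDendricLanguage.arnouxRauzyBar {F : Set (List A)} (hF : IsDendricLanguage F) (a : A) :
    IsDendricLanguage (imageLang (arnouxRauzyBar a) F) := by
  rw [imageLang_arnouxRauzyBar a hF.factorial hF.extendable]
  exact hF.arnouxRauzy a

end ArnouxRauzy

section Permutations
variable {A : Type*}

theorem wordImage_map (π : Equiv.Perm A) (v : List A) :
    wordImage (FreeMonoid.map π) v = v.map π := rfl

theorem mem_imageLang_map_iff (π : Equiv.Perm A) {F : Set (List A)} (hF : Factorial F)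
    (v : List A) : v ∈ imageLang (FreeMonoid.map π) F ↔ v.map π.symm ∈ F := by
  constructor
  · rintro ⟨u, hu, h⟩
    refine hF _ hu _ ?_
    have := h.map π.symm
    simpa [wordImage_map] using this
  · intro h
    exact ⟨_, h, by simp [wordImage_map]⟩

theorem IsDendricLanguage.map {F : Set (List A)} (hF : IsDendricLanguage F)
    (π : Equiv.Perm A) : IsDendricLanguage (imageLang (FreeMonoid.map π) F) := by
  have hmem := mem_imageLang_map_iff π hF.factorial
  refine ⟨factorial_imageLang _ _, extendable_imageLang (by simp [letterImage]) hF.extendable,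
    fun a => (hmem _).2 (hF.singleton_mem _), fun w hw => ?_⟩
  exact extensionGraph_isTree_congr π.symm (v := w.map π.symm) (fun a => by simp [hmem])
    (fun b => by simp [hmem]) (fun a b => by simp [hmem]) (hF.isTree _ ((hmem w).1 hw))

end Permutations


/-! ### Windows and languages of shift spaces -/

section Windows
variable {A : Type*}

@[simp] theorem length_window (x : ℤ → A) (k : ℤ) (n : ℕ) : (window x k n).length = n := by
  simp [window]

theorem window_getElem (x : ℤ → A) (k : ℤ) (n i : ℕ) (h : i < (window x k n).length) :
    (window x k n)[i] = x (k + i) := by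
  simp [window]

theorem window_eq_iff {x : ℤ → A} {k : ℤ} {w : List A} :
    window x k w.length = w ↔ ∀ i, ∀ h : i < w.length, x (k + i) = w[i] := by
  constructor
  · intro h i hi
    rw [← window_getElem x k w.length i (by simpa using hi)]
    simp only [h]
  · intro h
    refine List.ext_getElem (by simp) fun i h1 h2 => ?_
    rw [window_getElem, h i h2]

theorem window_add (x : ℤ → A) (k : ℤ) (m n : ℕ) :
    window x k (m + n) = window x k m ++ window x (k + m) n := by
  refine List.ext_getElem (by simp) fun i h1 h2 => ?_
  rw [window_getElem, List.getElem_append]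
  split_ifs with h
  · rw [window_getElem]
  · rw [window_getElem]
    congr 1
    simp only [length_window] at h ⊢
    omega

@[simp] theorem window_zero (x : ℤ → A) (k : ℤ) : window x k 0 = [] := rfl

theorem window_one (x : ℤ → A) (k : ℤ) : window x k 1 = [x k] := by simp [window]

theorem window_succ (x : ℤ → A) (k : ℤ) (n : ℕ) :
    window x k (n + 1) = x k :: window x (k + 1) n := by
  rw [add_comm, window_add, window_one]; simp

theorem window_succ' (x : ℤ → A) (k : ℤ) (n : ℕ) :
    window x k (n + 1) = window x k n ++ [x (k + n)] := by
  rw [window_add, window_one]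

theorem window_translate (x : ℤ → A) (j k : ℤ) (n : ℕ) :
    window (fun i => x (i + j)) k n = window x (k + j) n := by
  refine List.ext_getElem (by simp) fun i h1 h2 => ?_
  rw [window_getElem, window_getElem]
  congr 1; ring

theorem window_mem_language {X : Set (ℤ → A)} {x : ℤ → A} (hx : x ∈ X) (k : ℤ) (n : ℕ) :
    window x k n ∈ language X := ⟨x, hx, k, by simp⟩

theorem mem_language_iff {X : Set (ℤ → A)} {w : List A} :
    w ∈ language X ↔ ∃ x ∈ X, ∃ (k : ℤ) (n : ℕ), w = window x k n := by
  constructor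
  · rintro ⟨x, hx, k, h⟩
    exact ⟨x, hx, k, _, h⟩
  · rintro ⟨x, hx, k, n, rfl⟩
    exact window_mem_language hx k n

/-- A factor of a window is a window, at the expected position. -/
theorem eq_window_of_append_eq_window {x : ℤ → A} {k : ℤ} {n : ℕ} {s w t : List A}
    (h : s ++ w ++ t = window x k n) : w = window x (k + s.length) w.length := by
  have hn : n = s.length + w.length + t.length := by
    have := congrArg List.length h
    simp at this; omega
  subst hn
  rw [window_add, window_add] at h
  have := (List.append_inj (List.append_inj h (by simp)).1 (by simp)).2
  exact this

theorem factorial_language (X : Set (ℤ → A)) : Factorial (language X) := by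
  intro w hw v hv
  obtain ⟨x, hx, k, n, rfl⟩ := mem_language_iff.1 hw
  obtain ⟨s, t, h⟩ := hv
  exact ⟨x, hx, _, eq_window_of_append_eq_window h⟩

theorem extendable_language (X : Set (ℤ → A)) : Extendable (language X) := by
  intro w hw
  obtain ⟨x, hx, k, n, rfl⟩ := mem_language_iff.1 hw
  refine ⟨x (k - 1), x (k + n), ?_⟩
  have := window_mem_language hx (k - 1) (n + 1 + 1)
  rw [window_succ, window_succ'] at this
  simpa using this

theorem IsDendricShift.isDendricLanguage [TopologicalSpace A] {X : Set (ℤ → A)}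
    (hX : IsDendricShift X) (hA : IsOverAlphabet X) : IsDendricLanguage (language X) :=
  ⟨factorial_language X, extendable_language X, hA, hX.isTree⟩

theorem IsShiftSpace.translate_mem [TopologicalSpace A] {X : Set (ℤ → A)} (hX : IsShiftSpace X)
    {x : ℤ → A} (hx : x ∈ X) (j : ℤ) : (fun n => x (n + j)) ∈ X := by
  induction j with
  | zero => simpa using hx
  | succ j ih =>
    rw [← hX.shift_image]
    refine ⟨_, ih, ?_⟩
    funext n
    simp only [shift]; congr 1; ring
  | pred j ih =>
    rw [← hX.shift_image] at ih
    obtain ⟨y, hy, h⟩ := ih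
    convert hy using 1
    funext n
    have := congrFun h (n - 1)
    simp only [shift] at this
    rw [sub_add_cancel] at this
    rw [this]; congr 1; ring

theorem shift_iterate (k : ℕ) (z : ℤ → A) : shift^[k] z = fun n => z (n + k) := by
  induction k with
  | zero => simp
  | succ k ih =>
    rw [Function.iterate_succ_apply', ih]
    funext n
    simp only [shift]; congr 1; push_cast; ring

end Windows

/-! ### The image of a shift space under a non-erasing morphism -/

section ShiftImage
variable {A B : Type*} (σ : FreeMonoid A →* FreeMonoid B)

/-- The position at which `σ(x_n)` starts in `σ(x)`. -/
noncomputable def blockStart (x : ℤ → A) (n : ℤ) : ℤ :=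
  ∑ i ∈ Finset.Ico 0 n, ((letterImage σ (x i)).length : ℤ) -
    ∑ i ∈ Finset.Ico n 0, ((letterImage σ (x i)).length : ℤ)

theorem blockStart_zero (x : ℤ → A) : blockStart σ x 0 = 0 := by simp [blockStart]

theorem blockStart_succ (x : ℤ → A) (n : ℤ) :
    blockStart σ x (n + 1) = blockStart σ x n + ((letterImage σ (x n)).length : ℤ) := by
  unfold blockStart
  rcases le_or_gt 0 n with h | h
  · have h1 : Finset.Ico 0 (n + 1) = insert n (Finset.Ico 0 n) := by
      ext i; simp only [Finset.mem_Ico, Finset.mem_insert]; omega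
    have h2 : Finset.Ico (n + 1) 0 = ∅ := Finset.Ico_eq_empty (by omega)
    have h3 : Finset.Ico n 0 = ∅ := Finset.Ico_eq_empty (by omega)
    rw [h1, h2, h3, Finset.sum_insert (by simp)]
    simp; ring
  · have h1 : Finset.Ico n 0 = insert n (Finset.Ico (n + 1) 0) := by
      ext i; simp only [Finset.mem_Ico, Finset.mem_insert]; omega
    have h2 : Finset.Ico 0 (n + 1) = ∅ := Finset.Ico_eq_empty (by omega)
    have h3 : Finset.Ico 0 n = ∅ := Finset.Ico_eq_empty (by omega)
    rw [h1, h2, h3, Finset.sum_insert (by simp)]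
    simp

/-- The position function in `IsBiinfiniteImage` is determined. -/
theorem isBiinfiniteImage_iff {x : ℤ → A} {z : ℤ → B} :
    IsBiinfiniteImage σ x z ↔ ∀ n, ∀ i, ∀ h : i < (letterImage σ (x n)).length,
      z (blockStart σ x n + i) = (letterImage σ (x n))[i] := by
  simp only [← window_eq_iff]
  constructor
  · rintro ⟨L, h0, hL, h⟩
    have : L = blockStart σ x := by
      funext n
      induction n with
      | zero => rw [h0, blockStart_zero]
      | succ n ih => rw [hL, ih, blockStart_succ]
      | pred n ih =>
        have h1 := hL (-(n : ℤ) - 1)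
        have h2 := blockStart_succ σ x (-(n : ℤ) - 1)
        rw [sub_add_cancel] at h1 h2
        linarith
    rwa [this] at h
  · exact fun h => ⟨_, blockStart_zero σ x, blockStart_succ σ x, h⟩

variable {σ}

theorem strictMono_blockStart (hσ : ∀ a, letterImage σ a ≠ [])
    (x : ℤ → A) : StrictMono (blockStart σ x) := by
  refine strictMono_int_of_lt_succ fun n => ?_
  rw [blockStart_succ]
  have := List.length_pos_iff.2 (hσ (x n))
  omega

theorem exists_blockStart_le_lt (hσ : ∀ a, letterImage σ a ≠ []) (x : ℤ → A) (j : ℤ) :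
    ∃ n, blockStart σ x n ≤ j ∧ j < blockStart σ x (n + 1) := by
  have hmono := strictMono_blockStart hσ x
  have hge : ∀ n : ℕ, ∀ m : ℤ, blockStart σ x m + n ≤ blockStart σ x (m + n) := by
    intro n m
    induction n with
    | zero => simp
    | succ n ih =>
      have : blockStart σ x (m + n) < blockStart σ x (m + (n + 1 : ℕ)) := hmono (by simp)
      push_cast at *
      omega
  obtain ⟨n, hn, hmax⟩ := Int.exists_greatest_of_bdd (P := fun n => blockStart σ x n ≤ j)
    ⟨max j 0, fun n hn => by
      by_contra hlt
      push Not at hlt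
      obtain ⟨m, rfl⟩ := Int.eq_ofNat_of_zero_le (by omega : 0 ≤ n)
      have := hge m 0
      rw [blockStart_zero, zero_add] at this
      omega⟩
    ⟨min j 0, by
      have := hge (-(min j 0)).toNat (min j 0)
      have h2 : min j 0 + ((-(min j 0)).toNat : ℤ) = 0 := by omega
      rw [h2, blockStart_zero] at this
      omega⟩
  refine ⟨n, hn, ?_⟩
  by_contra hlt
  have := hmax (n + 1) (not_lt.1 hlt)
  omega

theorem exists_isBiinfiniteImage (hσ : ∀ a, letterImage σ a ≠ [])
    (x : ℤ → A) : ∃ z, IsBiinfiniteImage σ x z := by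
  choose N hN1 hN2 using exists_blockStart_le_lt hσ x
  have hlt (j : ℤ) : (j - blockStart σ x (N j)).toNat < (letterImage σ (x (N j))).length := by
    have h1 := hN1 j
    have h2 := hN2 j
    rw [blockStart_succ] at h2
    omega
  refine ⟨fun j => (letterImage σ (x (N j)))[(j - blockStart σ x (N j)).toNat]'(hlt j),
    (isBiinfiniteImage_iff σ).2 fun n i hi => ?_⟩
  have hn : N (blockStart σ x n + i) = n := by
    have h1 := hN1 (blockStart σ x n + i)
    have h2 := hN2 (blockStart σ x n + i)
    have hmono := strictMono_blockStart hσ x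
    have h3 : blockStart σ x n < blockStart σ x (N (blockStart σ x n + i) + 1) := by omega
    have h4 : blockStart σ x (N (blockStart σ x n + i)) < blockStart σ x (n + 1) := by
      rw [blockStart_succ]; omega
    have := hmono.lt_iff_lt.1 h3
    have := hmono.lt_iff_lt.1 h4
    omega
  simp only [hn]
  congr 1
  omega

theorem IsBiinfiniteImage.translate {x : ℤ → A} {z : ℤ → B} (h : IsBiinfiniteImage σ x z)
    (m : ℤ) : IsBiinfiniteImage σ (fun n => x (n + m)) fun n => z (n + blockStart σ x m) := by
  refine ⟨fun n => blockStart σ x (n + m) - blockStart σ x m, by simp, fun n => ?_, fun n => ?_⟩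
  · have := blockStart_succ σ x (n + m)
    rw [add_right_comm] at this
    simp only [this]; ring
  · rw [window_translate, sub_add_cancel]
    exact window_eq_iff.2 ((isBiinfiniteImage_iff σ).1 h (n + m))

theorem IsBiinfiniteImage.window_eq {x : ℤ → A} {z : ℤ → B} (h : IsBiinfiniteImage σ x z)
    (m : ℤ) (n : ℕ) :
    blockStart σ x (m + n) = blockStart σ x m + (wordImage σ (window x m n)).length ∧
    window z (blockStart σ x m) (wordImage σ (window x m n)).length =
      wordImage σ (window x m n) := by
  induction n with
  | zero => simp
  | succ n ih =>
    have h1 := window_eq_iff.2 ((isBiinfiniteImage_iff σ).1 h (m + n))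
    rw [window_succ', wordImage_append, wordImage_singleton, List.length_append]
    refine ⟨?_, ?_⟩
    · push_cast
      rw [← add_assoc, blockStart_succ, ih.1]; ring
    · rw [window_add, ih.2, ← ih.1, h1]

/-- The image of a shift space consists of all translates of the words `σ(x)`. -/
theorem mem_shiftImage_iff (hσ : ∀ a, letterImage σ a ≠ [])
    [TopologicalSpace A] {X : Set (ℤ → A)} (hX : IsShiftSpace X)
    {y : ℤ → B} : y ∈ shiftImage σ X ↔
      ∃ x ∈ X, ∃ z, IsBiinfiniteImage σ x z ∧ ∃ j : ℤ, y = fun n => z (n + j) := by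
  constructor
  · rintro ⟨x, hx, z, hz, k, hk, rfl⟩
    exact ⟨x, hx, z, hz, k, shift_iterate k z⟩
  · rintro ⟨x, hx, z, hz, j, rfl⟩
    obtain ⟨n, h1, h2⟩ := exists_blockStart_le_lt hσ x j
    refine ⟨_, hX.translate_mem hx n, _, hz.translate n, (j - blockStart σ x n).toNat, ?_, ?_⟩
    · rw [blockStart_succ] at h2
      simp only [zero_add]
      omega
    · rw [shift_iterate]
      funext m
      congr 1
      omega

theorem language_shiftImage (hσ : ∀ a, letterImage σ a ≠ [])
    [TopologicalSpace A] {X : Set (ℤ → A)} (hX : IsShiftSpace X) :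
    language (shiftImage σ X) = imageLang σ (language X) := by
  ext w
  rw [mem_language_iff]
  constructor
  · rintro ⟨y, hy, k, n, rfl⟩
    obtain ⟨x, hx, z, hz, j, rfl⟩ := (mem_shiftImage_iff hσ hX).1 hy
    rw [window_translate]
    obtain ⟨m, hm, -⟩ := exists_blockStart_le_lt hσ x (k + j)
    obtain ⟨m', -, hm'⟩ := exists_blockStart_le_lt hσ x (k + j + n)
    obtain ⟨l, hl⟩ : ∃ l : ℕ, m' + 1 = m + l := by
      refine Int.exists_add_of_le (le_of_lt ?_)
      exact (strictMono_blockStart hσ x).lt_iff_lt.1 (by omega)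
    obtain ⟨h1, h2⟩ := hz.window_eq m l
    refine ⟨window x m l, window_mem_language hx _ _, ?_⟩
    rw [← h2]
    rw [hl, h1] at hm'
    obtain ⟨p, hp⟩ := Int.exists_add_of_le hm
    obtain ⟨q, hq⟩ : ∃ q, (wordImage σ (window x m l)).length = p + n + q :=
      Nat.exists_eq_add_of_le (by omega)
    refine ⟨window z (blockStart σ x m) p, window z (blockStart σ x m + (p + n : ℕ)) q, ?_⟩
    rw [hq, window_add, window_add, ← hp]
  · rintro ⟨v, hv, hw⟩
    obtain ⟨x, hx, k, n, rfl⟩ := mem_language_iff.1 hv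
    obtain ⟨z, hz⟩ := exists_isBiinfiniteImage hσ x
    obtain ⟨s, t, h⟩ := hw
    rw [← (hz.window_eq k n).2] at h
    refine ⟨z, (mem_shiftImage_iff hσ hX).2 ⟨x, hx, z, hz, 0, by simp⟩, _, _,
      eq_window_of_append_eq_window h⟩

theorem continuous_blockStart [TopologicalSpace A] [DiscreteTopology A] (n : ℤ) :
    Continuous fun x : ℤ → A => blockStart σ x n := by
  unfold blockStart
  have (i : ℤ) : Continuous fun x : ℤ → A => ((letterImage σ (x i)).length : ℤ) :=
    (continuous_of_discreteTopology (f := fun a : A => ((letterImage σ a).length : ℤ))).comp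
      (continuous_apply i)
  exact (continuous_finsetSum _ fun i _ => this i).sub (continuous_finsetSum _ fun i _ => this i)

theorem isShiftSpace_shiftImage (hσ : ∀ a, letterImage σ a ≠ [])
    [Finite A] [TopologicalSpace A] [DiscreteTopology A]
    [TopologicalSpace B] [DiscreteTopology B] {X : Set (ℤ → A)} (hX : IsShiftSpace X) :
    IsShiftSpace (shiftImage σ X) := by
  refine ⟨?_, ?_⟩
  · -- The image is a finite union, over `k`, of projections of closed sets along a compact space.
    obtain ⟨M, hM⟩ := (Set.finite_range fun a => (letterImage σ a).length).bddAbove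
    have hset : shiftImage σ X = ⋃ k ∈ Finset.range M, Prod.snd '' {p : (ℤ → A) × (ℤ → B) |
        p.1 ∈ X ∧ k < (letterImage σ (p.1 0)).length ∧
          ∀ n, ∀ i, ∀ h : i < (letterImage σ (p.1 n)).length,
            p.2 (blockStart σ p.1 n + i - k) = (letterImage σ (p.1 n))[i]} := by
      ext y
      simp only [Set.mem_iUnion, Finset.mem_range]
      constructor
      · rintro ⟨x, hx, z, hz, k, hk, rfl⟩
        refine ⟨k, hk.trans_le (hM ⟨x 0, rfl⟩), (x, _), ⟨hx, hk, fun n i h => ?_⟩, rfl⟩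
        simp only [shift_iterate, sub_add_cancel]
        exact (isBiinfiniteImage_iff σ).1 hz n i h
      · rintro ⟨k, -, ⟨x, y⟩, ⟨hx, hk, h⟩, rfl⟩
        refine ⟨x, hx, fun j => y (j - k), (isBiinfiniteImage_iff σ).2 h, k, hk, ?_⟩
        rw [shift_iterate]
        simp
    rw [hset]
    refine Set.Finite.isClosed_biUnion (Finset.finite_toSet _) fun k _ => ?_
    apply isClosedMap_snd_of_compactSpace
    have h1 (n : ℤ) : Continuous fun p : (ℤ → A) × (ℤ → B) => p.1 n :=
      (continuous_apply n).comp continuous_fst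
    have h2 (n i : ℤ) : Continuous fun p : (ℤ → A) × (ℤ → B) =>
        p.2 (blockStart σ p.1 n + i - k) := by
      have hev : Continuous fun q : ℤ × (ℤ → B) => q.2 q.1 :=
        continuous_prod_of_discrete_left.2 fun j => continuous_apply j
      have hpos : Continuous fun p : (ℤ → A) × (ℤ → B) => blockStart σ p.1 n + i - k :=
        ((continuous_of_discreteTopology (f := fun j : ℤ => j + i - k)).comp
          (continuous_blockStart n)).comp continuous_fst
      exact hev.comp (hpos.prodMk continuous_snd)
    have h3 := (isClosed_discrete {a : A | k < (letterImage σ a).length}).preimage (h1 0)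
    have h4 := isClosed_iInter fun n => isClosed_iInter fun i : ℕ =>
      (isClosed_discrete {q : A × B | ∀ h : i < (letterImage σ q.1).length,
        q.2 = (letterImage σ q.1)[i]}).preimage ((h1 n).prodMk (h2 n i))
    convert (hX.isClosed.preimage continuous_fst).inter (h3.inter h4) using 1
    ext p
    simp
  · ext y
    constructor
    · rintro ⟨y, hy, rfl⟩
      obtain ⟨x, hx, z, hz, j, rfl⟩ := (mem_shiftImage_iff hσ hX).1 hy
      refine (mem_shiftImage_iff hσ hX).2 ⟨x, hx, z, hz, 1 + j, ?_⟩
      funext n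
      simp only [shift]; congr 1; ring
    · intro hy
      obtain ⟨x, hx, z, hz, j, rfl⟩ := (mem_shiftImage_iff hσ hX).1 hy
      refine ⟨_, (mem_shiftImage_iff hσ hX).2 ⟨x, hx, z, hz, j - 1, rfl⟩, ?_⟩
      funext n
      simp only [shift]; congr 1; ring

end ShiftImage

/-! ### The compositions of Arnoux-Rauzy morphisms preserve dendricity -/

section Sufficiency
variable {A : Type*}

theorem preservesDendricity_of_imageLang [Finite A] [TopologicalSpace A] [DiscreteTopology A]
    {σ : FreeMonoid A →* FreeMonoid A} (hσ : ∀ a, letterImage σ a ≠ [])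
    (h : ∀ F, IsDendricLanguage F → IsDendricLanguage (imageLang σ F)) :
    PreservesDendricity σ := by
  intro X hX hA
  refine ⟨isShiftSpace_shiftImage hσ hX.isShiftSpace, ?_⟩
  rw [language_shiftImage hσ hX.isShiftSpace]
  exact (h _ (hX.isDendricLanguage hA)).isTree

theorem injective_arnouxRauzyBarComp [DecidableEq A] (as : List A)
    {τ : FreeMonoid A →* FreeMonoid A} (hτ : Function.Injective τ) :
    Function.Injective (arnouxRauzyBarComp as τ) := by
  induction as with
  | nil => exact hτ
  | cons a as ih =>
    exact (injective_iff_wordImage.2 (wordImage_arnouxRauzyBar_injective a)).comp ih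

theorem IsDendricLanguage.arnouxRauzyBarComp [DecidableEq A] (as : List A)
    {τ : FreeMonoid A →* FreeMonoid A} {F : Set (List A)}
    (hτ : IsDendricLanguage (imageLang τ F)) :
    IsDendricLanguage (imageLang (arnouxRauzyBarComp as τ) F) := by
  induction as with
  | nil => exact hτ
  | cons a as ih =>
    have : DendricShift.arnouxRauzyBarComp (a :: as) τ =
      (DendricShift.arnouxRauzyBar a).comp (DendricShift.arnouxRauzyBarComp as τ) := rfl
    rw [this, imageLang_comp]
    exact ih.arnouxRauzyBar a

theorem count_wordImage_arnouxRauzyBar [DecidableEq A] {a b : A} (hb : b ≠ a) (v : List A) :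
    (wordImage (arnouxRauzyBar a) v).count b = v.count b := by
  induction v with
  | nil => simp
  | cons c v ih =>
    rw [wordImage_cons, List.count_append, ih, letterImage_arnouxRauzyBar, List.count_cons,
      add_comm]
    have hab : ¬ a = b := fun h => hb h.symm
    by_cases h1 : c = a
    · simp [h1, hab]
    · simp [h1, List.count_cons, hab]

theorem prefix_wordImage_arnouxRauzyBar [DecidableEq A] (a b : A) (v : List A) :
    [b] <+: wordImage (arnouxRauzyBar a) v ↔ [b] <+: v := by
  cases v with
  | nil => simp
  | cons c v =>
    rw [wordImage_cons, letterImage_arnouxRauzyBar]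
    split_ifs with h <;> simp [h]

theorem stronglyLeftProper_arnouxRauzyBarComp [DecidableEq A] {ℓ : A} (as : List A)
    (has : ∀ a ∈ as, a ≠ ℓ) {τ : FreeMonoid A →* FreeMonoid A}
    (hτ : ∀ b, [ℓ] <+: letterImage τ b ∧ (letterImage τ b).count ℓ = 1) (b : A) :
    [ℓ] <+: letterImage (arnouxRauzyBarComp as τ) b ∧
      (letterImage (arnouxRauzyBarComp as τ) b).count ℓ = 1 := by
  induction as with
  | nil => exact hτ b
  | cons a as ih =>
    have : arnouxRauzyBarComp (a :: as) τ =
      (arnouxRauzyBar a).comp (arnouxRauzyBarComp as τ) := rfl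
    rw [this, letterImage_comp, prefix_wordImage_arnouxRauzyBar,
      count_wordImage_arnouxRauzyBar (has a (by simp)).symm]
    exact ih fun c hc => has c (by simp [hc])

theorem letterImage_arnouxRauzy_comp_map [DecidableEq A] (ℓ : A) (π : Equiv.Perm A) (b : A) :
    letterImage ((arnouxRauzy ℓ).comp (FreeMonoid.map π)) b =
      if π b = ℓ then [ℓ] else [ℓ, π b] := by
  rw [letterImage_comp, ← letterImage_arnouxRauzy]; rfl

theorem arnouxRauzyBarComp_spec [Finite A] [DecidableEq A] [TopologicalSpace A]
    [DiscreteTopology A] {ℓ : A} (as : List A) (has : ∀ a ∈ as, a ≠ ℓ) (π : Equiv.Perm A) :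
    let σ := arnouxRauzyBarComp as ((arnouxRauzy ℓ).comp (FreeMonoid.map π))
    Function.Injective σ ∧ IsStronglyLeftProper σ ∧ PreservesDendricity σ := by
  intro σ
  have hslp := stronglyLeftProper_arnouxRauzyBarComp as has
    (τ := (arnouxRauzy ℓ).comp (FreeMonoid.map π)) (fun b => by
      rw [letterImage_arnouxRauzy_comp_map]
      split_ifs with h
      · simp
      · simp [h])
  refine ⟨injective_arnouxRauzyBarComp as ?_, ⟨ℓ, hslp⟩, preservesDendricity_of_imageLang ?_ ?_⟩
  · refine (injective_iff_wordImage.2 (wordImage_arnouxRauzy_injective ℓ)).comp ?_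
    exact List.map_injective_iff.2 π.injective
  · intro a h
    have := (hslp a).2
    simp [σ] at h
    simp [h] at this
  · intro F hF
    refine IsDendricLanguage.arnouxRauzyBarComp as ?_
    rw [imageLang_comp]
    exact (hF.map π).arnouxRauzy ℓ

end Sufficiency

/-! ### Dendric shifts with at most one transition -/

section OneTransition
variable {A : Type*}

/-- The bi-infinite words `⋯ c c d d ⋯` with `R c d`: consecutive letters are related by `R`, and
they differ at most once. -/
def oneTransitionShift (R : A → A → Prop) : Set (ℤ → A) :=
  {x | (∀ i, R (x i) (x (i + 1))) ∧ ∀ i j, i < j → x i = x (i + 1) ∨ x j = x (j + 1)}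

theorem replicate_append_replicate_mem {R : A → A → Prop} (hR : ∀ a, R a a) {c d : A}
    (h : R c d) (m n : ℕ) :
    List.replicate m c ++ List.replicate n d ∈ language (oneTransitionShift R) := by
  refine mem_language_iff.2 ⟨fun j => if j < 0 then c else d, ⟨fun i => ?_, fun i j hij => ?_⟩,
    -m, m + n, ?_⟩
  · rcases lt_trichotomy i (-1) with hi | rfl | hi
    · simp [show i < 0 by omega, show i + 1 < 0 by omega, hR]
    · simpa using h
    · simp [show ¬ i < 0 by omega, show ¬ i + 1 < 0 by omega, hR]
  · rcases lt_or_ge i (-1) with hi | hi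
    · simp [show i < 0 by omega, show i + 1 < 0 by omega]
    · simp [show ¬ j < 0 by omega, show ¬ j + 1 < 0 by omega]
  · refine List.ext_getElem (by simp) fun i h1 h2 => ?_
    rw [window_getElem, List.getElem_append]
    simp only [List.length_replicate, List.getElem_replicate]
    split_ifs <;> first | rfl | omega

theorem isShiftSpace_oneTransitionShift [TopologicalSpace A] [DiscreteTopology A]
    (R : A → A → Prop) : IsShiftSpace (oneTransitionShift R) := by
  refine ⟨?_, ?_⟩
  · have h1 (i : ℤ) : Continuous fun x : ℤ → A => x i := continuous_apply i
    have h2 := isClosed_iInter fun i : ℤ =>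
      (isClosed_discrete {q : A × A | R q.1 q.2}).preimage ((h1 i).prodMk (h1 (i + 1)))
    have h3 := isClosed_iInter fun i : ℤ => isClosed_iInter fun j : ℤ =>
      isClosed_iInter fun _ : i < j =>
      (isClosed_discrete {q : (A × A) × (A × A) | q.1.1 = q.1.2 ∨ q.2.1 = q.2.2}).preimage
        (((h1 i).prodMk (h1 (i + 1))).prodMk ((h1 j).prodMk (h1 (j + 1))))
    convert h2.inter h3 using 1
    ext x
    simp [oneTransitionShift]
  · ext x
    constructor
    · rintro ⟨x, hx, rfl⟩
      exact ⟨fun i => hx.1 (i + 1), fun i j hij => hx.2 (i + 1) (j + 1) (by omega)⟩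
    · intro hx
      refine ⟨fun n => x (n - 1), ⟨fun i => ?_, fun i j hij => ?_⟩, ?_⟩
      · have := hx.1 (i - 1)
        rw [sub_add_cancel] at this
        simpa using this
      · have := hx.2 (i - 1) (j - 1) (by omega)
        rw [sub_add_cancel, sub_add_cancel] at this
        simpa using this
      · funext n
        simp [shift]

theorem pair_mem_oneTransitionShift_iff {R : A → A → Prop} (hR : ∀ a, R a a) {c d : A} :
    [c, d] ∈ language (oneTransitionShift R) ↔ R c d := by
  constructor
  · rintro ⟨x, hx, k, h⟩
    simp only [List.length_cons, List.length_nil, zero_add, window_succ, window_zero,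
      List.cons.injEq, and_true] at h
    rw [h.1, h.2]
    exact hx.1 k
  · intro h
    exact replicate_append_replicate_mem hR h 1 1

/-- The extension graphs of the nonempty words are trees for every reflexive `R`. Hence such a shift
is dendric as soon as `R`, seen as a bipartite graph on two copies of the alphabet, is a tree. -/
theorem isTree_oneTransitionShift {R : A → A → Prop} (hR : ∀ a, R a a) {w : List A}
    (hw : w ∈ language (oneTransitionShift R)) (hne : w ≠ []) :
    (extensionGraph (language (oneTransitionShift R)) w).IsTree := by
  have hfac := factorial_language (oneTransitionShift R)
  have hext := extendable_language (oneTransitionShift R)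
  obtain ⟨x, hx, k, n, rfl⟩ := mem_language_iff.1 hw
  have hn : 0 < n := by
    rcases n with _ | n
    · simp at hne
    · omega
  by_cases hch : ∃ m : ℕ, m + 1 < n ∧ x (k + m) ≠ x (k + m + 1)
  · -- The transition lies inside the word, so that the letter before the word is its first letter.
    obtain ⟨m, hm, hxm⟩ := hch
    refine extensionGraph_isTree_of_leftExt hfac hext hw (a := x k) ?_
    rintro c ⟨y, hy, j, h⟩
    rw [List.length_cons, length_window, window_succ, List.cons.injEq] at h
    have heq : ∀ i : ℕ, i < n → x (k + i) = y (j + 1 + i) := by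
      intro i hi
      rw [← window_getElem x k n i (by simpa), ← window_getElem y (j + 1) n i (by simpa)]
      simp only [h.2]
    have h0 := heq 0 hn
    have h1 := heq m (by omega)
    have h2 := heq (m + 1) hm
    push_cast at h0 h1 h2
    rw [← add_assoc, ← add_assoc] at h2
    simp only [add_zero] at h0
    rw [h1, h2] at hxm
    rw [h.1, h0]
    exact (hy.2 j (j + 1 + m) (by omega)).resolve_right hxm
  · push Not at hch
    have hconst : ∀ m : ℕ, m < n → x (k + m) = x k := by
      intro m
      induction m with
      | zero => simp
      | succ m ih =>
        intro hm
        rw [← ih (by omega), hch m hm]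
        push_cast; rw [add_assoc]
    have hrep : window x k n = List.replicate n (x k) := by
      refine List.ext_getElem (by simp) fun i h1 h2 => ?_
      rw [window_getElem, hconst i (by simpa using h1), List.getElem_replicate]
    rw [hrep]
    generalize x k = d
    obtain ⟨n, rfl⟩ := Nat.exists_eq_add_one.2 hn
    have hconst := replicate_append_replicate_mem hR (hR d) (n + 1) 1
    refine extensionGraph_isTree_of_doubleStar (a := d) (b := d) ?_ ?_ ?_
    · rw [← List.replicate_add] at hconst
      exact hconst
    · exact hconst
    · intro c hc e he
      constructor
      · rintro ⟨y, hy, j, h⟩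
        simp only [List.length_cons, List.length_append, List.length_replicate,
          List.length_nil, zero_add] at h
        rw [window_succ, window_succ', List.cons.injEq] at h
        obtain ⟨h1, h2⟩ := h
        obtain ⟨h2, h3⟩ := List.append_inj' h2 rfl
        have h4 : y (j + 1) = d := by
          rw [window_succ, List.replicate_succ] at h2
          exact (List.cons.inj h2).1.symm
        have h5 : y (j + 1 + n) = d := by
          rw [window_succ', List.replicate_succ'] at h2
          have := (List.append_inj' h2 rfl).2
          simpa using this.symm
        have h6 := hy.2 j (j + 1 + n) (by omega)
        rw [h4, h5] at h6
        simp only [List.cons.injEq, and_true] at h3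
        rw [h1, h3]
        refine h6.imp id fun h => ?_
        rw [h]
        push_cast
        rw [← add_assoc]
      · rintro (rfl | rfl)
        · have := (pair_mem_oneTransitionShift_iff hR).1
            (hfac _ he [c, e] ⟨List.replicate n c, [], by simp [List.replicate_succ']⟩)
          exact replicate_append_replicate_mem hR this (n + 1 + 1) 1
        · have := (pair_mem_oneTransitionShift_iff hR).1
            (hfac _ hc [c, e] ⟨[], List.replicate n e, by simp [List.replicate_succ]⟩)
          have := replicate_append_replicate_mem hR this 1 (n + 1 + 1)
          rwa [List.replicate_succ' (n := n + 1)] at this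

/-- The transitions of a star with centre `c`: from `c` to the letters of `O`, and to `c` from the
other letters. -/
def starRel (c : A) (O : Set A) (a b : A) : Prop :=
  a = b ∨ (a = c ∧ b ∈ O) ∨ (b = c ∧ a ∉ O)

theorem starRel_refl (c : A) (O : Set A) (a : A) : starRel c O a a := Or.inl rfl

theorem isOverAlphabet_starShift (c : A) (O : Set A) :
    IsOverAlphabet (oneTransitionShift (starRel c O)) := fun a =>
  replicate_append_replicate_mem (starRel_refl c O) (starRel_refl c O a) 1 0

theorem isDendricShift_starShift [TopologicalSpace A] [DiscreteTopology A] (c : A) (O : Set A) :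
    IsDendricShift (oneTransitionShift (starRel c O)) := by
  classical
  refine ⟨isShiftSpace_oneTransitionShift _, fun w hw => ?_⟩
  by_cases hne : w = []
  swap
  · exact isTree_oneTransitionShift (starRel_refl c O) hw hne
  subst hne
  have hmem (a : A) := isOverAlphabet_starShift c O a
  have hpair {a b : A} := pair_mem_oneTransitionShift_iff (starRel_refl c O) (c := a) (d := b)
  -- The tree is rooted at the left copy of `c`. The right copies of `c` and of the letters of `O`
  -- are its children, and every other vertex hangs below one of these.
  refine extensionGraph_isTree_of_parent ⟨c, hmem c⟩
    (fun a => ⟨if (a : A) ∈ O then a else c, hmem _⟩)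
    (fun b => ⟨if (b : A) = c ∨ (b : A) ∈ O then c else b, hmem _⟩)
    (Sum.elim (fun a => if (a : A) = c then 0 else 2)
      fun b => if (b : A) = c ∨ (b : A) ∈ O then 1 else 3) ?_ ?_ ?_
  · rintro ⟨a, ha⟩ hne
    have hne : a ≠ c := fun h => hne (by simp [h])
    refine ⟨hpair.2 ?_, ?_⟩
    · by_cases h : a ∈ O <;> simp [h, starRel]
    · by_cases h : a ∈ O <;> simp [h, hne]
  · rintro ⟨b, hb⟩
    refine ⟨hpair.2 ?_, ?_⟩
    · by_cases h : b = c ∨ b ∈ O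
      · rcases h with h | h <;> simp [h, starRel]
      · simp [h, starRel]
    · by_cases h : b = c ∨ b ∈ O
      · simp [h]
      · simp only [h, if_false, Sum.elim_inl, Sum.elim_inr]
        split_ifs <;> omega
  · rintro ⟨a, ha⟩ ⟨b, hb⟩ h
    rcases hpair.1 h with h | ⟨h1, h2⟩ | ⟨h1, h2⟩
    · simp only at h
      subst h
      by_cases h1 : a = c <;> by_cases h2 : a ∈ O <;> simp [Subtype.ext_iff, h1, h2]
    · simp only at h1 h2
      simp [h1, h2]
    · simp only at h1 h2
      by_cases h3 : a = c <;> simp [Subtype.ext_iff, h1, h2, h3]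

end OneTransition

/-! ### Morphisms that preserve dendricity -/

section Necessity
variable {A : Type*}

/-- The longest common prefix of an injective family of words that avoid `ℓ`, the end of each word
being marked by `ℓ`; `g x` is the letter that follows it in the word of index `x`. -/
theorem exists_common_prefix [Nontrivial A] {ℓ : A} {u : A → List A} (hu : Function.Injective u)
    (hℓ : ∀ x, ℓ ∉ u x) :
    ∃ (p : List A) (g : A → A), (∀ x, p ++ [g x] <+: u x ++ [ℓ]) ∧ ∃ x y, g x ≠ g y := by
  obtain ⟨x₀, x₁, hne⟩ := exists_pair_ne A
  by_contra hcon
  have key : ∀ n, ∃ p : List A, p.length = n ∧ ∀ x, p <+: u x := by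
    intro n
    induction n with
    | zero => exact ⟨[], rfl, fun x => List.nil_prefix⟩
    | succ n ih =>
      obtain ⟨p, hp, hpu⟩ := ih
      have h1 : ∀ x, ∃ c, p ++ [c] <+: u x ++ [ℓ] := by
        intro x
        obtain ⟨r, hr⟩ := hpu x
        rw [← hr]
        rcases r with _ | ⟨c, r⟩
        · exact ⟨ℓ, by simp⟩
        · exact ⟨c, r ++ [ℓ], by simp⟩
      choose g hg using h1
      have hconst : ∀ x, g x = g x₀ := by
        by_contra h
        push Not at h
        obtain ⟨x, hx⟩ := h
        exact hcon ⟨p, g, hg, x, x₀, hx⟩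
      have hcases : ∀ x, p ++ [g x₀] <+: u x ∨ (g x₀ = ℓ ∧ u x = p) := by
        intro x
        obtain ⟨r, hr⟩ := hpu x
        obtain ⟨t, ht⟩ := hg x
        rw [hconst x, ← hr, List.append_assoc, List.append_assoc] at ht
        have ht := List.append_cancel_left ht
        rcases r with _ | ⟨c, r⟩
        · simp only [List.cons_append, List.nil_append, List.cons.injEq] at ht
          exact Or.inr ⟨ht.1, by simpa using hr.symm⟩
        · simp only [List.cons_append, List.nil_append, List.cons.injEq] at ht
          exact Or.inl ⟨r, by rw [← hr, ht.1]; simp⟩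
      by_cases hg0 : g x₀ = ℓ
      · -- All words would be equal to `p`.
        have : ∀ x, u x = p := by
          intro x
          rcases hcases x with h | h
          · exact absurd (h.subset (by simp [hg0])) (hℓ x)
          · exact h.2
        exact absurd (hu ((this x₀).trans (this x₁).symm)) hne
      · exact ⟨p ++ [g x₀], by simp [hp], fun x => (hcases x).resolve_right fun h => hg0 h.1⟩
  obtain ⟨p, hp, hpu⟩ := key ((u x₀).length + 1)
  have := (hpu x₀).length_le
  omega

theorem exists_common_suffix [Nontrivial A] {ℓ : A} {u : A → List A} (hu : Function.Injective u)
    (hℓ : ∀ x, ℓ ∉ u x) :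
    ∃ (s : List A) (f : A → A), (∀ x, f x :: s <:+ ℓ :: u x) ∧ ∃ x y, f x ≠ f y := by
  obtain ⟨p, f, h, hf⟩ := exists_common_prefix (ℓ := ℓ) (u := fun x => (u x).reverse)
    (List.reverse_injective.comp hu) (by simpa using hℓ)
  refine ⟨p.reverse, f, fun x => ?_, hf⟩
  rw [← List.reverse_prefix]
  simpa using h x

/-- Gluing the left copies of the letters along `f` and the right copies along `g` creates no
4-cycle in any star only if nothing is glued, provided that neither side collapses to a point. -/
theorem injective_of_starRel {f g : A → A} (hf : ∃ x y, f x ≠ f y) (hg : ∃ x y, g x ≠ g y)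
    (h : ∀ (c : A) (O : Set A) (x₁ y₁ x₂ y₂ x₃ y₃ x₄ y₄ : A), starRel c O x₁ y₁ →
      starRel c O x₂ y₂ → starRel c O x₃ y₃ → starRel c O x₄ y₄ → f x₁ = f x₂ → f x₃ = f x₄ →
      g y₁ = g y₃ → g y₂ = g y₄ → f x₁ = f x₃ ∨ g y₁ = g y₂) :
    Function.Injective f ∧ Function.Injective g := by
  have exists_ne {k : A → A} (hk : ∃ x y, k x ≠ k y) (x : A) : ∃ z, k z ≠ k x := by
    obtain ⟨y, z, hyz⟩ := hk
    by_cases hy : k y = k x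
    · exact ⟨z, fun hz => hyz (hy.trans hz.symm)⟩
    · exact ⟨y, hy⟩
  -- The star with centre `j`, all transitions leaving `j`.
  have hout (j x y : A) (h1 : f x = f y) (h2 : f j ≠ f x) : g x = g y :=
    (h j Set.univ j x j y x x y y (Or.inr (Or.inl ⟨rfl, trivial⟩))
      (Or.inr (Or.inl ⟨rfl, trivial⟩)) (Or.inl rfl) (Or.inl rfl) rfl h1 rfl rfl).resolve_left h2
  -- The star with centre `j`, all transitions entering `j`.
  have hin (j x y : A) (h1 : g x = g y) (h2 : g j ≠ g x) : f x = f y :=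
    (h j ∅ x x x j y y y j (Or.inl rfl) (Or.inr (Or.inr ⟨rfl, id⟩)) (Or.inl rfl)
      (Or.inr (Or.inr ⟨rfl, id⟩)) rfl rfl h1 rfl).resolve_right h2.symm
  have hginj : Function.Injective g := by
    intro x y hxy
    by_contra hne
    obtain ⟨z, hz⟩ := exists_ne hg x
    have hfxy := hin z x y hxy hz
    by_cases hfz : f z = f x
    · obtain ⟨j, hj⟩ := exists_ne hf x
      exact hz (hout j x z hfz.symm hj).symm
    · -- The star with centre `z` and the transitions `z → x` and `y → z`.
      rcases h z {x} z x z z x x y z (Or.inr (Or.inl ⟨rfl, rfl⟩)) (Or.inl rfl) (Or.inl rfl)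
        (Or.inr (Or.inr ⟨rfl, fun h => hne h.symm⟩)) rfl hfxy rfl rfl with h1 | h1
      · exact hfz h1
      · exact hz h1.symm
  refine ⟨fun x y hxy => ?_, hginj⟩
  obtain ⟨j, hj⟩ := exists_ne hf x
  exact hginj (hout j x y hxy hj)

theorem forall_eq_of_isChain {a b : A} (hab : a ≠ b) :
    ∀ (w : List A) (c : A), c ≠ b → (c :: w).IsChain (fun c d => c = b ∨ d = a) →
      ∀ d ∈ w, d = a := by
  intro w
  induction w with
  | nil => simp
  | cons e w ih =>
    intro c hc h d hd
    rw [List.isChain_cons_cons] at h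
    obtain rfl : e = a := h.1.resolve_left hc
    rcases List.mem_cons.1 hd with rfl | hd
    · rfl
    · exact ih e hab h.2 d hd

/-- A word is an image under `ᾱ_a` if each of its letters other than `a` is followed by `a`. The
final letter `ℓ ≠ a` expresses that the word does not end before such an `a`. -/
theorem exists_eq_wordImage_arnouxRauzyBar [DecidableEq A] {a ℓ : A} (hℓ : ℓ ≠ a) :
    ∀ (n : ℕ) (w : List A), w.length ≤ n → (w ++ [ℓ]).IsChain (fun c d => c = a ∨ d = a) →
      ∃ v, w = wordImage (arnouxRauzyBar a) v := by
  intro n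
  induction n with
  | zero =>
    intro w hw _
    exact ⟨[], by simpa using hw⟩
  | succ n ih =>
    intro w hw h
    rcases w with _ | ⟨c, w⟩
    · exact ⟨[], by simp⟩
    simp only [List.length_cons, Nat.add_le_add_iff_right] at hw
    by_cases hc : c = a
    · obtain ⟨v, hv⟩ := ih w hw h.tail
      exact ⟨c :: v, by rw [wordImage_cons, letterImage_arnouxRauzyBar, ← hv]; simp [hc]⟩
    · rcases w with _ | ⟨d, w⟩
      · simp [hc, hℓ] at h
      · simp only [List.cons_append, List.isChain_cons_cons, hc, false_or] at h
        have hw' : w.length ≤ n := by simp at hw; omega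
        obtain ⟨v, hv⟩ := ih w hw' h.2.tail
        exact ⟨c :: v, by rw [wordImage_cons, letterImage_arnouxRauzyBar, ← hv]; simp [hc, h.1]⟩

theorem length_add_count_le_wordImage_arnouxRauzyBar [DecidableEq A] {a ℓ : A} (hℓ : ℓ ≠ a)
    (v : List A) : v.length + v.count ℓ ≤ (wordImage (arnouxRauzyBar a) v).length := by
  induction v with
  | nil => simp
  | cons c v ih =>
    rw [wordImage_cons, letterImage_arnouxRauzyBar, List.length_append, List.count_cons,
      List.length_cons]
    by_cases hc : c = a
    · have : ¬ a = ℓ := fun h => hℓ h.symm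
      simp [hc, this]; omega
    · simp only [hc, if_false, List.length_cons, List.length_nil]
      split_ifs <;> omega

/-- The dichotomy that drives the desubstitution: either `σ` is `α_ℓ` up to a permutation of the
letters, or every letter other than `a` is followed by `a` in the words `σ(x)ℓ`. -/
theorem eq_arnouxRauzy_or_isChain [Finite A] [Nontrivial A] [DecidableEq A]
    {σ : FreeMonoid A →* FreeMonoid A} (hσ : Function.Injective (letterImage σ)) {ℓ : A}
    {u : A → List A} (hu : ∀ x, letterImage σ x = ℓ :: u x) (hℓ : ∀ x, ℓ ∉ u x)
    (hsq : ∀ c O, NoSquare (imageLang σ (language (oneTransitionShift (starRel c O))))) :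
    (∃ π : Equiv.Perm A, σ = (arnouxRauzy ℓ).comp (FreeMonoid.map π)) ∨
      ∃ a, a ≠ ℓ ∧
        ∀ x, (letterImage σ x ++ [ℓ]).IsChain (fun c d => c = a ∨ d = a) := by
  have huinj : Function.Injective u := fun x y h => hσ (by rw [hu, hu, h])
  obtain ⟨p, g, hp, hg⟩ := exists_common_prefix huinj hℓ
  obtain ⟨s, f, hs, hf⟩ := exists_common_suffix huinj hℓ
  have hright {c : A} {O : Set A} {w : List A}
      (hw : w ∈ language (oneTransitionShift (starRel c O))) :
      ∃ z, w ++ [z] ∈ language (oneTransitionShift (starRel c O)) :=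
    (extendable_language _).exists_right (factorial_language _) hw
  -- A transition `x y` yields the extension `f x`, `g y` of `s ℓ p`.
  have hedge (c : A) (O : Set A) (x y : A) (hxy : starRel c O x y) :
      f x :: ((s ++ ℓ :: p) ++ [g y]) ∈
        imageLang σ (language (oneTransitionShift (starRel c O))) := by
    obtain ⟨z, hz⟩ := hright ((pair_mem_oneTransitionShift_iff (starRel_refl c O)).2 hxy)
    refine ⟨_, hz, ?_⟩
    obtain ⟨t, ht⟩ := hs x
    obtain ⟨r, hr⟩ := hp y
    refine ⟨t, r ++ u z, ?_⟩
    have : wordImage σ ([x, y] ++ [z]) = (ℓ :: u x) ++ ℓ :: (u y ++ [ℓ]) ++ u z := by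
      simp [wordImage_cons, hu]
    rw [this, ← ht, ← hr]
    simp
  obtain ⟨hfinj, hginj⟩ := injective_of_starRel hf hg (by
    intro c O x₁ y₁ x₂ y₂ x₃ y₃ x₄ y₄ h1 h2 h3 h4 e1 e2 e3 e4
    refine hsq c O (s ++ ℓ :: p) _ _ _ _ (hedge c O _ _ h1) ?_ ?_ ?_
    · rw [e1]; exact hedge c O _ _ h2
    · rw [e3]; exact hedge c O _ _ h3
    · rw [e2, e4]; exact hedge c O _ _ h4)
  have hfsurj := Finite.surjective_of_injective hfinj
  have hgsurj := Finite.surjective_of_injective hginj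
  -- For words of length two, any of the test shifts will do.
  obtain ⟨x₀⟩ : Nonempty A := inferInstance
  set G := imageLang σ (language (oneTransitionShift (starRel x₀ ∅)))
  have hGfac : Factorial G := factorial_imageLang _ _
  have hblock (x : A) : ℓ :: u x ++ [ℓ] ∈ G := by
    obtain ⟨z, hz⟩ := hright (isOverAlphabet_starShift x₀ ∅ x)
    exact ⟨_, hz, [], u z, by simp [wordImage_cons, hu]⟩
  obtain ⟨a, s', hs'⟩ : ∃ a s', s ++ [ℓ] = a :: s' :=
    List.exists_cons_of_ne_nil (by simp)
  obtain ⟨p', b, hp'⟩ : ∃ p' b, ℓ :: p = p' ++ [b] := by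
    rcases List.eq_nil_or_concat (ℓ :: p) with h | ⟨p', b, h⟩
    · simp at h
    · exact ⟨p', b, by rw [h, List.concat_eq_append]⟩
  have hza (z : A) : [z, a] ∈ G := by
    obtain ⟨x, rfl⟩ := hfsurj z
    obtain ⟨t, ht⟩ := hs x
    refine hGfac _ (hblock x) _ ⟨t, s', ?_⟩
    rw [← ht, List.append_assoc _ _ [ℓ], List.cons_append, hs']
    simp
  have hbz (z : A) : [b, z] ∈ G := by
    obtain ⟨y, rfl⟩ := hgsurj z
    obtain ⟨r, hr⟩ := hp y
    refine hGfac _ (hblock y) _ ⟨p', r, ?_⟩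
    rw [List.cons_append, ← hr, ← List.cons_append, ← List.cons_append, hp']
    simp
  -- The extension graph of the empty word is the double star given by `hza` and `hbz`.
  have hpair {c d : A} (hcd : [c, d] ∈ G) : c = b ∨ d = a :=
    hsq x₀ ∅ [] c b d a hcd (hza c) (hbz d) (hbz a)
  have hchain (x : A) : (ℓ :: u x ++ [ℓ]).IsChain (fun c d => c = b ∨ d = a) := by
    rw [List.isChain_iff_forall_rel_of_append_cons_cons]
    intro c d l₁ l₂ h
    exact hpair (hGfac _ (hblock x) _ ⟨l₁, l₂, by rw [h]; simp⟩)
  by_cases hnil : ∃ x, u x = []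
  · left
    obtain ⟨x, hx⟩ := hnil
    have hp0 : p = [] := by
      have := (hp x).length_le
      rw [hx] at this
      simpa using this
    have hs0 : s = [] := by
      have := (hs x).length_le
      rw [hx] at this
      simpa using this
    obtain rfl : ℓ = a := by simpa [hs0] using congrArg List.head? hs'
    obtain rfl : ℓ = b := by simpa [hp0] using congrArg List.getLast? hp'
    refine ⟨Equiv.ofBijective g ⟨hginj, hgsurj⟩, hom_ext_of_letterImage fun y => ?_⟩
    rw [letterImage_arnouxRauzy_comp_map, hu]
    change _ = if g y = ℓ then [ℓ] else [ℓ, g y]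
    obtain ⟨r, hr⟩ := hp y
    have hc := hchain y
    have hy := hℓ y
    rw [hp0] at hr
    rcases h : u y with _ | ⟨c, w⟩
    · rw [h] at hr
      simp only [List.nil_append, List.cons_append, List.cons.injEq] at hr
      simp [hr.1]
    · rw [h] at hr hc hy
      simp only [List.nil_append, List.cons_append, List.cons.injEq] at hr
      simp only [List.mem_cons, not_or] at hy
      rcases w with _ | ⟨d, w⟩
      · simp [hr.1, Ne.symm hy.1]
      · simp only [List.cons_append, List.isChain_cons_cons] at hc
        rcases hc.2.1 with h | h
        · exact absurd h.symm hy.1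
        · simp [h] at hy
  · right
    push Not at hnil
    have haℓ : a ≠ ℓ := by
      obtain ⟨x, hx⟩ := hfsurj ℓ
      have hsx : s <:+ u x := by
        obtain ⟨t, ht⟩ := hs x
        rcases t with _ | ⟨c, t⟩
        · simp only [List.nil_append, List.cons.injEq] at ht
          exact ⟨[], ht.2⟩
        · simp only [List.cons_append, List.cons.injEq] at ht
          exact ⟨t ++ [f x], by simp [← ht.2]⟩
      rcases s with _ | ⟨c, s⟩
      · -- Otherwise `σ(x)` would end with a second `ℓ`.
        exfalso
        obtain ⟨t, ht⟩ := hs x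
        rcases t with _ | ⟨e, t⟩
        · simp only [List.nil_append, List.cons.injEq] at ht
          exact hnil x ht.2.symm
        · simp only [List.cons_append, List.cons.injEq] at ht
          exact hℓ x (by rw [← ht.2, hx]; simp)
      · simp only [List.cons_append, List.cons.injEq] at hs'
        rintro rfl
        exact hℓ x (hsx.subset (by simp [hs'.1]))
    have hbℓ : b ≠ ℓ := by
      obtain ⟨y, hy⟩ := hgsurj ℓ
      have hpy : p <+: u y := by
        have h := (List.prefix_append p [g y]).trans (hp y)
        rcases List.prefix_concat_iff.1 h with h | h
        · obtain ⟨r, hr⟩ := hp y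
          rw [h] at hr
          have := congrArg List.length hr
          simp at this
        · exact h
      rcases List.eq_nil_or_concat p with rfl | ⟨q, c, rfl⟩
      · -- Otherwise `ℓ` would be followed by a second `ℓ` in `σ(y)`.
        exfalso
        obtain ⟨r, hr⟩ := hp y
        rcases h : u y with _ | ⟨e, w⟩
        · exact hnil y h
        · rw [h, hy] at hr
          simp only [List.nil_append, List.cons_append, List.cons.injEq] at hr
          exact hℓ y (by rw [h, hr.1]; simp)
      · rw [List.concat_eq_append] at hp' hpy
        rw [← List.cons_append] at hp'
        obtain rfl : c = b := by simpa using (List.append_inj' hp' rfl).2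
        rintro rfl
        exact hℓ y (hpy.subset (by simp))
    -- If `a ≠ b`, then only `a` can follow `ℓ`, then only `a`, and so on up to the next `ℓ`.
    have hab : a = b := by
      by_contra hab
      exact haℓ (forall_eq_of_isChain hab _ ℓ hbℓ.symm (hchain x₀) ℓ (by simp)).symm
    subst hab
    exact ⟨a, haℓ, fun x => by rw [hu]; exact hchain x⟩

theorem noSquare_of_arnouxRauzyBar [DecidableEq A] {a : A} {F : Set (List A)}
    (hF : Factorial F) (hE : Extendable F) (h : NoSquare (imageLang (arnouxRauzyBar a) F)) :
    NoSquare F := by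
  rw [imageLang_arnouxRauzyBar a hF hE] at h
  have hmem := mem_imageLang_arnouxRauzy_iff a hF hE
  exact fun w c c' d d' h1 h2 h3 h4 => h _ c c' d d' ((hmem w c d).2 h1) ((hmem w c d').2 h2)
    ((hmem w c' d).2 h3) ((hmem w c' d').2 h4)

theorem exists_eq_arnouxRauzyBarComp [Fintype A] [Nontrivial A] [DecidableEq A] {ℓ : A} :
    ∀ (n : ℕ) (σ : FreeMonoid A →* FreeMonoid A), ∑ x, (letterImage σ x).length ≤ n →
      Function.Injective (letterImage σ) →
      (∀ x, [ℓ] <+: letterImage σ x ∧ (letterImage σ x).count ℓ = 1) →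
      (∀ c O, NoSquare (imageLang σ (language (oneTransitionShift (starRel c O))))) →
      ∃ (as : List A) (π : Equiv.Perm A), (∀ a ∈ as, a ≠ ℓ) ∧
        σ = arnouxRauzyBarComp as ((arnouxRauzy ℓ).comp (FreeMonoid.map π)) := by
  intro n
  induction n with
  | zero =>
    intro σ hn _ hℓ _
    obtain ⟨x⟩ : Nonempty A := inferInstance
    have h1 := (hℓ x).1.length_le
    have h2 := Finset.single_le_sum (f := fun x => (letterImage σ x).length)
      (fun _ _ => Nat.zero_le _) (Finset.mem_univ x)
    simp only [List.length_cons, List.length_nil] at h1 h2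
    omega
  | succ n ih =>
    intro σ hn hσ hℓ hsq
    choose u hu using fun x => (hℓ x).1
    have hu' (x : A) : letterImage σ x = ℓ :: u x := (hu x).symm
    have hnot (x : A) : ℓ ∉ u x := by
      have := (hℓ x).2
      rw [hu', List.count_cons_self] at this
      exact List.count_eq_zero.1 (by omega)
    rcases eq_arnouxRauzy_or_isChain hσ hu' hnot hsq with ⟨π, rfl⟩ | ⟨a, ha, hchain⟩
    · exact ⟨[], π, by simp, rfl⟩
    choose v hv using fun x =>
      exists_eq_wordImage_arnouxRauzyBar ha.symm _ (letterImage σ x) le_rfl (hchain x)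
    let τ : FreeMonoid A →* FreeMonoid A := FreeMonoid.lift fun x => FreeMonoid.ofList (v x)
    have hτ (x : A) : letterImage τ x = v x := by
      simp [τ, letterImage, FreeMonoid.lift_eval_of]
    have hστ : σ = (arnouxRauzyBar a).comp τ :=
      hom_ext_of_letterImage fun x => by rw [letterImage_comp, hτ, hv]
    have hℓτ (x : A) : [ℓ] <+: letterImage τ x ∧ (letterImage τ x).count ℓ = 1 := by
      have := hℓ x
      rwa [hv, prefix_wordImage_arnouxRauzyBar, count_wordImage_arnouxRauzyBar ha.symm,
        ← hτ] at this
    have hlen : ∑ x, (letterImage τ x).length < ∑ x, (letterImage σ x).length := by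
      refine Finset.sum_lt_sum_of_nonempty Finset.univ_nonempty fun x _ => ?_
      have h1 := length_add_count_le_wordImage_arnouxRauzyBar ha.symm (v x)
      have h2 := (hℓτ x).2
      rw [← hv] at h1
      rw [hτ] at h2 ⊢
      omega
    obtain ⟨as, π, has, h⟩ := ih τ (by omega)
      (fun x y h => hσ (by rw [hv x, hv y, ← hτ, ← hτ, h])) hℓτ (fun c O => by
        refine noSquare_of_arnouxRauzyBar (a := a) (factorial_imageLang _ _)
          (extendable_imageLang (fun x h => ?_) (extendable_language _)) ?_
        · have := (hℓτ x).2
          simp [h] at this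
        · rw [← imageLang_comp, ← hστ]
          exact hsq c O)
    refine ⟨a :: as, π, ?_, ?_⟩
    · intro c hc
      rcases List.mem_cons.1 hc with rfl | hc
      · exact ha
      · exact has c hc
    · rw [hστ, h]; rfl

end Necessity
end DendricShift

theorem mainTheorem5 {A : Type*} [Fintype A] [DecidableEq A]
    [TopologicalSpace A] [DiscreteTopology A] (hA : 2 ≤ Fintype.card A)
    (σ : FreeMonoid A →* FreeMonoid A) :
    (Function.Injective σ ∧ DendricShift.IsStronglyLeftProper σ ∧
        DendricShift.PreservesDendricity σ) ↔
      ∃ (ℓ : A) (as : List A) (π : Equiv.Perm A), (∀ a ∈ as, a ≠ ℓ) ∧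
        σ = DendricShift.arnouxRauzyBarComp as
          ((DendricShift.arnouxRauzy ℓ).comp (FreeMonoid.map π)) := by
  have : Nontrivial A := Fintype.one_lt_card_iff_nontrivial.1 hA
  constructor
  · rintro ⟨hinj, ⟨ℓ, hℓ⟩, hpres⟩
    have hne (a : A) : DendricShift.letterImage σ a ≠ [] := fun h => by
      have := (hℓ a).2
      simp [h] at this
    obtain ⟨as, π, has, h⟩ := DendricShift.exists_eq_arnouxRauzyBarComp _ σ le_rfl
      (fun x y h => FreeMonoid.of_injective (hinj (FreeMonoid.toList.injective h))) hℓ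
      (fun c O => by
        have hX := DendricShift.isDendricShift_starShift c O
        rw [← DendricShift.language_shiftImage hne hX.isShiftSpace]
        exact DendricShift.noSquare_of_isTree (DendricShift.factorial_language _)
          (hpres _ hX (DendricShift.isOverAlphabet_starShift c O)).isTree)
    exact ⟨ℓ, as, π, has, h⟩
  · rintro ⟨ℓ, as, π, has, rfl⟩
    exact DendricShift.arnouxRauzyBarComp_spec as has π
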